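/- Let $(M^n,g)$ be a smooth Riemannian manifold, with $\mathrm{Ric}$ its Ricci tensor and $R$ its scalar curvature, and let $f,\rho\in C^\infty(M)$ satisfy $$\mathrm{Ric}+\mathrm{Hess} f=\rho\, g ,$$ that is, $(M^n,g,f,\rho)$ is a gradient Ricci almost soliton. Then: (1) $R$ is differentiable and, at every point $x$ and for every $v\in T_xM$, $$dR(v)=2\,\mathrm{Ric}(v,\nabla f)+2(n-1)\,d\rho(v);$$ in normal coordinates at $x$ this reads $\partial_iR=2R_{ij}\partial_jf+2(n-1)\partial_i\rho$. (2) Let $o\in M$ and let $\gamma:(a,b)\to M$, $a<0<b$, be a geodesic with $\gamma(0)=o$. A dot denotes $\frac{d}{dr}$ along $\gamma$, so $\dot f=\frac{d}{dr}f(\gamma(r))$ and $\dot\rho=\frac{d}{dr}\rho(\gamma(r))$. Then the function $F(r)=(R+|\nabla f|^2)(\gamma(r))$ satisfies $$\dot F=2\rho\,\dot f+2(n-1)\,\dot\rho\qquad\text{on }(a,b).$$ Conversely, if $0\le\ell<b$ and $F:[0,\ell]\to\mathbb R$ is continuous, satisfies this equation on $(0,\ell)$, and $F(0)=R(o)+|\nabla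 f|^2(o)$, then $$R(\gamma(r))+|\nabla f|^2(\gamma(r))=F(r)\qquad\text{for all } r\in[0,\ell].$$ -/

import Mathlib

open Bundle Set
open scoped Manifold ContDiff

noncomputable section

namespace AlmostSoliton

variable {n : ℕ} {M : Type*} [TopologicalSpace M] [ChartedSpace (EuclideanSpace ℝ (Fin n)) M]
  [IsManifold (𝓡 n) ∞ M]
  [RiemannianBundle (fun x : M => TangentSpace (𝓡 n) x)]

instance finiteDimensionalTangentSpace (x : M) : FiniteDimensional ℝ (TangentSpace (𝓡 n) x) :=
  inferInstanceAs (FiniteDimensional ℝ (EuclideanSpace ℝ (Fin n)))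

/-- The extension of a tangent vector `v` at `x` to a vector field which is smooth near `x`: it has
constant coefficients in the preferred chart at `x`. -/
abbrev localExt {x : M} (v : TangentSpace (𝓡 n) x) : Π y : M, TangentSpace (𝓡 n) y :=
  FiberBundle.extend (EuclideanSpace ℝ (Fin n)) v

/-- The right-hand side of the Koszul formula,
`X⟨Y,Z⟩ + Y⟨X,Z⟩ - Z⟨X,Y⟩ + ⟨[X,Y],Z⟩ - ⟨[X,Z],Y⟩ - ⟨[Y,Z],X⟩` at the point `x`. -/
def koszul (X Y Z : Π x : M, TangentSpace (𝓡 n) x) (x : M) : ℝ :=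
  mvfderiv (𝓡 n) (fun y => inner ℝ (Y y) (Z y)) x (X x)
    + mvfderiv (𝓡 n) (fun y => inner ℝ (X y) (Z y)) x (Y x)
    - mvfderiv (𝓡 n) (fun y => inner ℝ (X y) (Y y)) x (Z x)
    + inner ℝ (VectorField.mlieBracket (𝓡 n) X Y x) (Z x)
    - inner ℝ (VectorField.mlieBracket (𝓡 n) X Z x) (Y x)
    - inner ℝ (VectorField.mlieBracket (𝓡 n) Y Z x) (X x)

/-- The Levi-Civita connection: `nabla X Y = ∇_X Y` is the vector field determined by
`2 ⟨∇_X Y, Z⟩ = koszul X Y Z`. -/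
def nabla (X Y : Π x : M, TangentSpace (𝓡 n) x) (x : M) : TangentSpace (𝓡 n) x :=
  let e := stdOrthonormalBasis ℝ (TangentSpace (𝓡 n) x)
  ∑ i, (koszul X Y (localExt (e i)) x / 2) • e i

/-- The Riemann curvature `R(X,Y)Z = ∇_X ∇_Y Z - ∇_Y ∇_X Z - ∇_[X,Y] Z`. -/
def riem (X Y Z : Π x : M, TangentSpace (𝓡 n) x) (x : M) : TangentSpace (𝓡 n) x :=
  nabla X (nabla Y Z) x - nabla Y (nabla X Z) x
    - nabla (VectorField.mlieBracket (𝓡 n) X Y) Z x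

/-- The Ricci curvature `Ric(u,v)`, the trace of `w ↦ R(w,u)v`; it is positive on round spheres. -/
def ricci {x : M} (u v : TangentSpace (𝓡 n) x) : ℝ :=
  let e := stdOrthonormalBasis ℝ (TangentSpace (𝓡 n) x)
  ∑ i, inner ℝ (riem (localExt (e i)) (localExt u) (localExt v) x) (e i)

/-- The scalar curvature, the trace of the Ricci curvature. -/
def scal (x : M) : ℝ :=
  let e := stdOrthonormalBasis ℝ (TangentSpace (𝓡 n) x)
  ∑ i, ricci (e i) (e i)

/-- The Riemannian gradient `∇f`, i.e. `⟨∇f, v⟩ = df(v)`. -/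
def grad (f : M → ℝ) (x : M) : TangentSpace (𝓡 n) x :=
  let e := stdOrthonormalBasis ℝ (TangentSpace (𝓡 n) x)
  ∑ i, mvfderiv (𝓡 n) f x (e i) • e i

/-- The Hessian `Hess f (u,v) = ⟨∇_u ∇f, v⟩`. -/
def hess (f : M → ℝ) {x : M} (u v : TangentSpace (𝓡 n) x) : ℝ :=
  inner ℝ (nabla (localExt u) (grad f) x) v

variable (n) in
/-- `(M, g, f, ρ)` is a gradient Ricci almost soliton: `f` and `ρ` are smooth functions and
`Ric + Hess f = ρ g`. -/
structure IsGradientRicciAlmostSoliton (f ρ : M → ℝ) : Prop where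
  smooth_potential : ContMDiff (𝓡 n) 𝓘(ℝ, ℝ) ∞ f
  smooth_soliton : ContMDiff (𝓡 n) 𝓘(ℝ, ℝ) ∞ ρ
  soliton_eq : ∀ (x : M) (u v : TangentSpace (𝓡 n) x),
    ricci u v + hess f u v = ρ x * inner ℝ u v

variable (n) in
/-- The velocity `γ'(t)` of a curve. -/
def velocity (γ : ℝ → M) (t : ℝ) : TangentSpace (𝓡 n) (γ t) :=
  mfderiv 𝓘(ℝ, ℝ) (𝓡 n) γ t (1 : ℝ)

variable (n) in
/-- The covariant acceleration `D_t γ'` at time `t`. In the preferred chart at `γ t`, the extension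
`V` of `γ'(t)` with constant coefficients satisfies `∇_V V = Γ(γ', γ')`, so this is the usual
expression `γ'' + Γ(γ', γ')`. -/
def acceleration (γ : ℝ → M) (t : ℝ) : TangentSpace (𝓡 n) (γ t) :=
  let a : EuclideanSpace ℝ (Fin n) :=
    deriv (deriv (fun s => extChartAt (𝓡 n) (γ t) (γ s))) t
  let V := localExt (velocity n γ t)
  (show TangentSpace (𝓡 n) (γ t) from a) + nabla V V (γ t)

variable (n) in
/-- `γ` restricts to a smooth geodesic on the open interval `(a, b)`. -/
def IsGeodesicOn (γ : ℝ → M) (a b : ℝ) : Prop :=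
  ContMDiffOn 𝓘(ℝ, ℝ) (𝓡 n) ∞ γ (Ioo a b) ∧ ∀ t ∈ Ioo a b, acceleration n γ t = 0

end AlmostSoliton

end

open Bundle Set
open scoped Manifold ContDiff

noncomputable section

namespace AlmostSoliton

open Filter Topology VectorField

/-! Let `E` be a local orthonormal frame, W a vector field and S = ∑ ⟨∇²_{W,E_i}∇f, E_i⟩.
Differentiating Ric = ρ g - Hess f along W and tracing gives dR(W) = n dρ(W) - S. Taking the
divergence puts W in the second slot of ∇² instead; commuting the two derivatives by the Ricci
identity gives div Ric(W) = dρ(W) - Ric(W, ∇f) - S. The contracted Bianchi identity dR = 2 div Ric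
then eliminates S and leaves the formula for dR. The ingredients are
`covRic_eq_of_isGradientRicciAlmostSoliton`, `nablaSq_sub_nablaSq_swap` and `contracted_bianchi`.

Along a curve, |∇f|² has derivative 2 Hess f(γ', ∇f). Added to dR(γ'), it completes 2 Ric(γ', ∇f) to
2 (Ric + Hess f)(γ', ∇f) = 2ρ df(γ'). Two solutions with the same initial value differ by a function
with zero derivative.

The bulk of the file is the calculus behind this. `nabla`, `ricci` and `scal` are defined pointwise
from `stdOrthonormalBasis` and `localExt`, whose choice at each point need not vary smoothly.
Tensoriality (`TensorialNear`) removes the dependence on these choices, and smooth local orthonormal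
frames then allow differentiation. The second Bianchi identity rests on vanishing torsion and the
Jacobi identity. -/

section

/-! ### Germs of smooth functions and vector fields. -/

section Smoothness

variable {n : ℕ} {M : Type*} [TopologicalSpace M] [ChartedSpace (EuclideanSpace ℝ (Fin n)) M]

variable (n) in
/-- The function `f` is smooth on a neighbourhood of `x`. -/
def SmoothNear (f : M → ℝ) (x : M) : Prop :=
  ∀ᶠ y in 𝓝 x, ContMDiffAt (𝓡 n) 𝓘(ℝ, ℝ) ∞ f y

/-- The vector field `X` is smooth on a neighbourhood of `x`. -/
def FieldSmoothNear [IsManifold (𝓡 n) ∞ M] (X : Π y : M, TangentSpace (𝓡 n) y) (x : M) : Prop :=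
  ∀ᶠ y in 𝓝 x, ContMDiffAt (𝓡 n) (𝓡 n).tangent ∞
    (fun z => (X z : TangentBundle (𝓡 n) M)) y

variable {f g : M → ℝ} {x : M}

lemma SmoothNear.contMDiffAt (hf : SmoothNear n f x) : ContMDiffAt (𝓡 n) 𝓘(ℝ, ℝ) ∞ f x :=
  hf.self_of_nhds

lemma SmoothNear.mdiff (hf : SmoothNear n f x) : MDifferentiableAt (𝓡 n) 𝓘(ℝ, ℝ) f x :=
  hf.contMDiffAt.mdifferentiableAt (by simp)

lemma SmoothNear.eventually (hf : SmoothNear n f x) : ∀ᶠ y in 𝓝 x, SmoothNear n f y :=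
  eventually_eventually_nhds.2 hf

lemma SmoothNear.congr (hf : SmoothNear n f x) (h : g =ᶠ[𝓝 x] f) : SmoothNear n g x := by
  filter_upwards [hf, h.eventuallyEq_nhds] with y hy hy'
  exact hy.congr_of_eventuallyEq hy'

lemma SmoothNear.add (hf : SmoothNear n f x) (hg : SmoothNear n g x) : SmoothNear n (f + g) x := by
  filter_upwards [hf, hg] with y h1 h2 using h1.add h2

lemma SmoothNear.neg (hf : SmoothNear n f x) : SmoothNear n (-f) x := by
  filter_upwards [hf] with y h1 using h1.neg

lemma SmoothNear.sub (hf : SmoothNear n f x) (hg : SmoothNear n g x) : SmoothNear n (f - g) x := by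
  filter_upwards [hf, hg] with y h1 h2 using h1.sub h2

lemma SmoothNear.mul (hf : SmoothNear n f x) (hg : SmoothNear n g x) : SmoothNear n (f * g) x := by
  filter_upwards [hf, hg] with y h1 h2 using h1.mul h2

lemma SmoothNear.sum {ι : Type*} {s : Finset ι} {f : ι → M → ℝ}
    (hf : ∀ i ∈ s, SmoothNear n (f i) x) : SmoothNear n (fun y => ∑ i ∈ s, f i y) x := by
  have : ∀ᶠ y in 𝓝 x, ∀ i ∈ s, ContMDiffAt (𝓡 n) 𝓘(ℝ, ℝ) ∞ (f i) y :=
    (eventually_all_finset s).2 hf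
  filter_upwards [this] with y hy using contMDiffAt_finsetSum hy

lemma smoothNear_const (c : ℝ) : SmoothNear n (fun _ : M => c) x :=
  Eventually.of_forall fun _ => contMDiffAt_const

lemma SmoothNear.comp_contDiffAt {φ : ℝ → ℝ} (hf : SmoothNear n f x)
    (hφ : ∀ᶠ y in 𝓝 x, ContDiffAt ℝ ∞ φ (f y)) : SmoothNear n (fun y => φ (f y)) x := by
  filter_upwards [hf, hφ] with y h1 h2
  exact h2.contMDiffAt.comp y h1

variable [IsManifold (𝓡 n) ∞ M] {X Y : Π y : M, TangentSpace (𝓡 n) y}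

lemma FieldSmoothNear.contMDiffAt (hX : FieldSmoothNear X x):
    ContMDiffAt (𝓡 n) (𝓡 n).tangent ∞
    (fun z => (X z : TangentBundle (𝓡 n) M)) x :=
  hX.self_of_nhds

lemma FieldSmoothNear.mdiff (hX : FieldSmoothNear X x):
    MDifferentiableAt (𝓡 n) (𝓡 n).tangent
    (fun z => (X z : TangentBundle (𝓡 n) M)) x :=
  hX.contMDiffAt.mdifferentiableAt (by simp)

lemma FieldSmoothNear.eventually (hX : FieldSmoothNear X x) :
    ∀ᶠ y in 𝓝 x, FieldSmoothNear X y :=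
  eventually_eventually_nhds.2 hX

lemma FieldSmoothNear.congr (hX : FieldSmoothNear X x) (h : Y =ᶠ[𝓝 x] X) :
    FieldSmoothNear Y x := by
  filter_upwards [hX, h.eventuallyEq_nhds] with y hy hy'
  exact hy.congr_of_eventuallyEq (hy'.mono fun z hz => by simp [hz])

lemma FieldSmoothNear.add (hX : FieldSmoothNear X x) (hY : FieldSmoothNear Y x) :
    FieldSmoothNear (X + Y) x := by
  filter_upwards [hX, hY] with y h1 h2 using h1.add_section h2

lemma FieldSmoothNear.sub (hX : FieldSmoothNear X x) (hY : FieldSmoothNear Y x) :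
    FieldSmoothNear (X - Y) x := by
  filter_upwards [hX, hY] with y h1 h2 using h1.sub_section h2

lemma FieldSmoothNear.smul (hf : SmoothNear n f x) (hX : FieldSmoothNear X x) :
    FieldSmoothNear (f • X) x := by
  filter_upwards [hf, hX] with y h1 h2 using h1.smul_section h2

lemma FieldSmoothNear.sum {ι : Type*} {s : Finset ι} {X : ι → Π y : M, TangentSpace (𝓡 n) y}
    (hX : ∀ i ∈ s, FieldSmoothNear (X i) x) : FieldSmoothNear (fun y => ∑ i ∈ s, X i y) x := by
  have : ∀ᶠ y in 𝓝 x, ∀ i ∈ s, ContMDiffAt (𝓡 n) (𝓡 n).tangent ∞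
    (fun z => (X i z : TangentBundle (𝓡 n) M)) y :=
    (eventually_all_finset s).2 hX
  filter_upwards [this] with y hy using ContMDiffAt.sum_section hy

lemma fieldSmoothNear_localExt (v : TangentSpace (𝓡 n) x) : FieldSmoothNear (localExt v) x := by
  obtain ⟨s, hs, h⟩ := FiberBundle.exists_contMDiffOn_extend (k := ∞) (𝓡 n) (EuclideanSpace ℝ (Fin n)) v
  filter_upwards [eventually_mem_nhds_iff.2 hs] with y hy using h.contMDiffAt hy

lemma FieldSmoothNear.mlieBracket (hX : FieldSmoothNear X x) (hY : FieldSmoothNear Y x) :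
    FieldSmoothNear (mlieBracket (𝓡 n) X Y) x := by
  filter_upwards [hX, hY] with y h1 h2
  -- The bracket loses one derivative, which is harmless because ∞ + 1 = ∞.
  have : IsManifold (𝓡 n) (((⊤ : ℕ∞) : WithTop ℕ∞) + 1) M := by simpa using ‹IsManifold (𝓡 n) ∞ M›
  have : IsManifold (𝓡 n) (minSmoothness ℝ 2) M := by
    simp only [minSmoothness_of_isRCLikeNormedField]
    infer_instance
  exact ContMDiffAt.mlieBracket_vectorField (m := ⊤) (n := ⊤) h1 h2
    (by rw [minSmoothness_of_isRCLikeNormedField]; rfl)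

lemma mlieBracket_jacobi {U V W : Π y : M, TangentSpace (𝓡 n) y} (hU : FieldSmoothNear U x)
    (hV : FieldSmoothNear V x) (hW : FieldSmoothNear W x) :
    mlieBracket (𝓡 n) U (mlieBracket (𝓡 n) V W) x =
      mlieBracket (𝓡 n) (mlieBracket (𝓡 n) U V) W x
        + mlieBracket (𝓡 n) V (mlieBracket (𝓡 n) U W) x := by
  have : IsManifold (𝓡 n) (minSmoothness ℝ 3) M := by
    simp only [minSmoothness_of_isRCLikeNormedField]
    exact inferInstance
  have h2 : minSmoothness ℝ 2 ≤ ∞ := by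
    simp only [minSmoothness_of_isRCLikeNormedField]
    exact ENat.LEInfty.out
  exact leibniz_identity_mlieBracket_apply (hU.contMDiffAt.of_le h2) (hV.contMDiffAt.of_le h2)
    (hW.contMDiffAt.of_le h2)

end Smoothness

/-! ### Derivatives along vector fields and the Leibniz rules of the Lie bracket. -/

section Derivations

variable {n : ℕ} {M : Type*} [TopologicalSpace M] [ChartedSpace (EuclideanSpace ℝ (Fin n)) M]

/-- The derivative `X f` of a function along a vector field. -/
def dirDeriv (X : Π y : M, TangentSpace (𝓡 n) y) (f : M → ℝ) (y : M) : ℝ :=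
  mvfderiv (𝓡 n) f y (X y)

variable {f g : M → ℝ} {x : M} {X Y Z : Π y : M, TangentSpace (𝓡 n) y}

lemma _root_.Filter.EventuallyEq.mvfderiv_eq (h : f =ᶠ[𝓝 x] g) :
    mvfderiv (𝓡 n) f x = mvfderiv (𝓡 n) g x := by
  ext v
  simp only [mvfderiv, h.mfderiv_eq]
  rfl

lemma dirDeriv_congr (h : f =ᶠ[𝓝 x] g) : dirDeriv X f x = dirDeriv X g x := by
  simp only [dirDeriv, h.mvfderiv_eq]

lemma dirDeriv_congr_field (h : X x = Y x) : dirDeriv X f x = dirDeriv Y f x := by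
  simp only [dirDeriv, h]

lemma dirDeriv_add (hf : SmoothNear n f x) (hg : SmoothNear n g x) :
    dirDeriv X (f + g) x = dirDeriv X f x + dirDeriv X g x := by
  simp [dirDeriv, mvfderiv_add hf.mdiff hg.mdiff]

lemma dirDeriv_sub (hf : SmoothNear n f x) (hg : SmoothNear n g x) :
    dirDeriv X (f - g) x = dirDeriv X f x - dirDeriv X g x := by
  simp [dirDeriv, mvfderiv_sub hf.mdiff hg.mdiff]

lemma dirDeriv_mul (hf : SmoothNear n f x) (hg : SmoothNear n g x) :
    dirDeriv X (f * g) x = f x * dirDeriv X g x + g x * dirDeriv X f x := by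
  simp [dirDeriv, mvfderiv_mul hf.mdiff hg.mdiff]

lemma dirDeriv_const (c : ℝ) : dirDeriv X (fun _ => c) x = 0 := by
  simp [dirDeriv, mvfderiv_const]

lemma dirDeriv_sum {ι : Type*} {s : Finset ι} {f : ι → M → ℝ}
    (hf : ∀ i ∈ s, SmoothNear n (f i) x) :
    dirDeriv X (fun y => ∑ i ∈ s, f i y) x = ∑ i ∈ s, dirDeriv X (f i) x := by
  classical
  induction s using Finset.induction_on with
  | empty => simpa using dirDeriv_const 0
  | insert a s ha ih =>
    simp only [Finset.sum_insert ha]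
    rw [← ih fun i hi => hf i (Finset.mem_insert_of_mem hi)]
    exact dirDeriv_add (hf a (Finset.mem_insert_self a s))
      (.sum fun i hi => hf i (Finset.mem_insert_of_mem hi))

lemma dirDeriv_add_field : dirDeriv (X + Y) f x = dirDeriv X f x + dirDeriv Y f x := by
  simp [dirDeriv]

lemma dirDeriv_smul_field : dirDeriv (g • X) f x = g x * dirDeriv X f x := by
  simp [dirDeriv]

variable [IsManifold (𝓡 n) ∞ M]

lemma mlieBracket_smul_right' (hf : SmoothNear n f x) (hY : FieldSmoothNear Y x) :
    mlieBracket (𝓡 n) X (f • Y) x = dirDeriv X f x • Y x + f x • mlieBracket (𝓡 n) X Y x := by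
  exact mlieBracket_smul_right hf.mdiff hY.mdiff

lemma mlieBracket_smul_left' (hf : SmoothNear n f x) (hX : FieldSmoothNear X x) :
    mlieBracket (𝓡 n) (f • X) Y x = -dirDeriv Y f x • X x + f x • mlieBracket (𝓡 n) X Y x := by
  exact mlieBracket_smul_left hf.mdiff hX.mdiff

lemma mlieBracket_add_right' (hY : FieldSmoothNear Y x) (hZ : FieldSmoothNear Z x) :
    mlieBracket (𝓡 n) X (Y + Z) x = mlieBracket (𝓡 n) X Y x + mlieBracket (𝓡 n) X Z x := by
  exact mlieBracket_add_right hY.mdiff hZ.mdiff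

lemma mlieBracket_add_left' (hY : FieldSmoothNear Y x) (hZ : FieldSmoothNear Z x) :
    mlieBracket (𝓡 n) (Y + Z) X x = mlieBracket (𝓡 n) Y X x + mlieBracket (𝓡 n) Z X x := by
  exact mlieBracket_add_left hY.mdiff hZ.mdiff

end Derivations

end

section

/-! ### Traces in orthonormal bases, and local orthonormal frames. -/

section LinearAlgebra

variable {V : Type*} [NormedAddCommGroup V] [InnerProductSpace ℝ V]
  {ι κ : Type*} [Fintype ι] [Fintype κ]

lemma inner_sum_smul_eq (e : OrthonormalBasis ι ℝ V) (L : V →ₗ[ℝ] ℝ) (v : V) :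
    inner ℝ (∑ i, L (e i) • e i) v = L v := by
  conv_rhs => rw [← e.sum_repr' v]
  simp [sum_inner, inner_smul_left, mul_comm]

/-- Expanding one argument of each diagonal term in the other basis turns both traces into the same
double sum. -/
lemma sum_apply_self_eq (e : OrthonormalBasis ι ℝ V) (f : OrthonormalBasis κ ℝ V)
    (B : V →ₗ[ℝ] V →ₗ[ℝ] ℝ) : ∑ i, B (e i) (e i) = ∑ j, B (f j) (f j) := by
  have h1 (i : ι) : B (e i) (e i) = ∑ j, inner ℝ (f j) (e i) * B (f j) (e i) := by
    have h := congrArg (fun v => B v (e i)) (f.sum_repr' (e i))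
    simpa using h.symm
  have h2 (j : κ) : B (f j) (f j) = ∑ i, inner ℝ (e i) (f j) * B (f j) (e i) := by
    have h := congrArg (fun v => B (f j) v) (e.sum_repr' (f j))
    simpa using h.symm
  simp only [h1, h2]
  rw [Finset.sum_comm]
  simp only [real_inner_comm]

end LinearAlgebra

variable {n : ℕ} {M : Type*} [TopologicalSpace M] [ChartedSpace (EuclideanSpace ℝ (Fin n)) M]

lemma finrank_tangentSpace (x : M) : Module.finrank ℝ (TangentSpace (𝓡 n) x) = n :=
  finrank_euclideanSpace_fin (𝕜 := ℝ)

lemma smoothNear_inv {f : M → ℝ} {x : M} (hf : SmoothNear n f x) (h0 : f x ≠ 0) :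
    SmoothNear n (fun y => (f y)⁻¹) x := by
  refine hf.comp_contDiffAt (φ := fun t => t⁻¹) ?_
  filter_upwards [hf.contMDiffAt.continuousAt.eventually_ne h0] with y hy
  exact contDiffAt_inv ℝ hy

variable [RiemannianBundle (fun x : M => TangentSpace (𝓡 n) x)]

lemma exists_orthonormalBasis_of_orthonormal {E : Fin n → Π y : M, TangentSpace (𝓡 n) y} {y : M}
    (h : Orthonormal ℝ (fun i => E i y)) :
    ∃ b : OrthonormalBasis (Fin n) ℝ (TangentSpace (𝓡 n) y), ∀ i, b i = E i y := by
  have hc : Fintype.card (Fin n) = Module.finrank ℝ (TangentSpace (𝓡 n) y) := by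
    rw [finrank_tangentSpace, Fintype.card_fin]
  refine ⟨OrthonormalBasis.mk h
    (h.linearIndependent.span_eq_top_of_card_eq_finrank' hc).ge, fun i => ?_⟩
  exact congrFun (OrthonormalBasis.coe_mk h _) i

variable [IsManifold (𝓡 n) ∞ M]

/-- The function `⟨X, Y⟩`. -/
def innerField (X Y : Π y : M, TangentSpace (𝓡 n) y) (y : M) : ℝ := inner ℝ (X y) (Y y)

/-- A local orthonormal frame near `x`. -/
structure IsOrthonormalFrameNear (E : Fin n → Π y : M, TangentSpace (𝓡 n) y) (x : M) : Prop where
  smooth : ∀ i, FieldSmoothNear (E i) x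
  orthonormal : ∀ᶠ y in 𝓝 x, Orthonormal ℝ (fun i => E i y)

lemma IsOrthonormalFrameNear.eventually {E : Fin n → Π y : M, TangentSpace (𝓡 n) y} {x : M}
    (h : IsOrthonormalFrameNear E x) : ∀ᶠ y in 𝓝 x, IsOrthonormalFrameNear E y := by
  filter_upwards [eventually_all.2 fun i => (h.smooth i).eventually,
    eventually_eventually_nhds.2 h.orthonormal] with y h1 h2 using ⟨h1, h2⟩

lemma IsOrthonormalFrameNear.exists_basis {E : Fin n → Π y : M, TangentSpace (𝓡 n) y} {x : M}
    (h : IsOrthonormalFrameNear E x) :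
    ∃ b : OrthonormalBasis (Fin n) ℝ (TangentSpace (𝓡 n) x), ∀ i, b i = E i x :=
  exists_orthonormalBasis_of_orthonormal h.orthonormal.self_of_nhds

variable [IsContMDiffRiemannianBundle (𝓡 n) ∞ (EuclideanSpace ℝ (Fin n))
      (fun x : M => TangentSpace (𝓡 n) x)]
variable {f g : M → ℝ} {x : M} {X Y Z : Π y : M, TangentSpace (𝓡 n) y}

lemma FieldSmoothNear.innerField (hX : FieldSmoothNear X x) (hY : FieldSmoothNear Y x) :
    SmoothNear n (innerField X Y) x := by
  filter_upwards [hX, hY] with y h1 h2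
  exact ContMDiffAt.inner_bundle h1 h2

/-- Gram–Schmidt is applied pointwise to the frame of a trivialization. Its coefficients are
quotients of smooth functions whose denominators do not vanish near `x`, so smoothness passes from
earlier vectors to later ones. -/
lemma exists_isOrthonormalFrameNear (x : M) :
    ∃ E : Fin n → Π y : M, TangentSpace (𝓡 n) y, IsOrthonormalFrameNear E x := by
  let t := trivializationAt (EuclideanSpace ℝ (Fin n)) (fun y : M => TangentSpace (𝓡 n) y) x
  let b := (EuclideanSpace.basisFun (Fin n) ℝ).toBasis
  let s : Fin n → Π y : M, TangentSpace (𝓡 n) y := t.localFrame b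
  have hx : x ∈ t.baseSet := FiberBundle.mem_baseSet_trivializationAt' x
  have ht : ∀ᶠ y in 𝓝 x, y ∈ t.baseSet := t.open_baseSet.mem_nhds hx
  have hs (i : Fin n) : FieldSmoothNear (s i) x := by
    filter_upwards [ht] with y hy using contMDiffAt_localFrame_of_mem ∞ t b i hy
  have hli : ∀ᶠ y in 𝓝 x, LinearIndependent ℝ (fun i => s i y) := by
    filter_upwards [ht] with y hy
    exact (t.isLocalFrameOn_localFrame_baseSet (𝓡 n) ∞ b).linearIndependent hy
  let G : Fin n → Π y : M, TangentSpace (𝓡 n) y :=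
    fun i y => InnerProductSpace.gramSchmidt ℝ (fun j => s j y) i
  have hG0 (i : Fin n) : inner ℝ (G i x) (G i x) ≠ (0 : ℝ) := by
    simpa using InnerProductSpace.gramSchmidt_ne_zero i hli.self_of_nhds
  have hG (i : Fin n) : FieldSmoothNear (G i) x := by
    induction i using WellFoundedLT.induction with
    | _ i ih =>
      have hc (j : Fin n) (hj : j ∈ Finset.Iio i) : FieldSmoothNear
          ((innerField (G j) (s i) * fun y => (innerField (G j) (G j) y)⁻¹) • G j) x := by
        have := ih j (Finset.mem_Iio.1 hj)
        exact .smul ((this.innerField (hs i)).mul (smoothNear_inv (this.innerField this) (hG0 j)))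
          this
      refine ((hs i).sub (.sum hc)).congr (Eventually.of_forall fun y => ?_)
      have := InnerProductSpace.gramSchmidt_def'' ℝ (fun j => s j y) i
      rw [← sub_eq_iff_eq_add] at this
      simp [G, innerField, ← this, div_eq_mul_inv]
      rfl
  refine ⟨fun i => (fun y => (√(innerField (G i) (G i) y))⁻¹) • G i, fun i => ?_, ?_⟩
  · have hpos : 0 < innerField (G i) (G i) x := real_inner_self_nonneg.lt_of_ne (hG0 i).symm
    have hsm := (hG i).innerField (hG i)
    refine .smul (smoothNear_inv (hsm.comp_contDiffAt ?_) (Real.sqrt_pos.2 hpos).ne') (hG i)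
    filter_upwards [hsm.contMDiffAt.continuousAt.eventually_ne hpos.ne'] with y hy
    exact Real.contDiffAt_sqrt hy
  · filter_upwards [hli] with y hy
    convert InnerProductSpace.gramSchmidtNormed_orthonormal hy with i
    simp [G, innerField, InnerProductSpace.gramSchmidtNormed]

end

section

variable {n : ℕ} {M : Type*} [TopologicalSpace M] [ChartedSpace (EuclideanSpace ℝ (Fin n)) M]
  [IsManifold (𝓡 n) ∞ M] [RiemannianBundle (fun x : M => TangentSpace (𝓡 n) x)]

omit [RiemannianBundle (fun x : M => TangentSpace (𝓡 n) x)] in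
lemma localExt_self {x : M} (v : TangentSpace (𝓡 n) x) : localExt v x = v :=
  FiberBundle.extend_apply_self _ v

/-! ### Tensoriality and the Koszul form. -/

section InnerField

variable {f : M → ℝ} {X Y Z : Π y : M, TangentSpace (𝓡 n) y}

omit [IsManifold (𝓡 n) ∞ M]

lemma innerField_comm : innerField X Y = innerField Y X :=
  funext fun _ => real_inner_comm _ _

lemma innerField_add_left : innerField (X + Y) Z = innerField X Z + innerField Y Z :=
  funext fun _ => inner_add_left _ _ _

lemma innerField_add_right : innerField X (Y + Z) = innerField X Y + innerField X Z :=
  funext fun _ => inner_add_right _ _ _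

lemma innerField_smul_left : innerField (f • X) Y = f * innerField X Y :=
  funext fun _ => real_inner_smul_left _ _ _

lemma innerField_smul_right : innerField X (f • Y) = f * innerField X Y :=
  funext fun _ => real_inner_smul_right _ _ _

lemma koszul_eq (x : M) : koszul X Y Z x = dirDeriv X (innerField Y Z) x
    + dirDeriv Y (innerField X Z) x - dirDeriv Z (innerField X Y) x
    + inner ℝ (mlieBracket (𝓡 n) X Y x) (Z x) - inner ℝ (mlieBracket (𝓡 n) X Z x) (Y x)
    - inner ℝ (mlieBracket (𝓡 n) Y Z x) (X x) := rfl

end InnerField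

lemma IsOrthonormalFrameNear.eventuallyEq_sum {x : M} {E : Fin n → Π y : M, TangentSpace (𝓡 n) y}
    (hE : IsOrthonormalFrameNear E x) (X : Π y : M, TangentSpace (𝓡 n) y) :
    X =ᶠ[𝓝 x] fun y => ∑ i, (innerField (E i) X • E i) y := by
  filter_upwards [hE.eventually] with y hy
  obtain ⟨b, hb⟩ := hy.exists_basis
  have := b.sum_repr' (X y)
  simp only [hb] at this
  exact this.symm

variable [IsContMDiffRiemannianBundle (𝓡 n) ∞ (EuclideanSpace ℝ (Fin n))
      (fun x : M => TangentSpace (𝓡 n) x)]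
variable {f g : M → ℝ} {x : M} {X X' Y Y' Z Z' : Π y : M, TangentSpace (𝓡 n) y}

/-- Smoothness of X f is read off from that of brackets: [X, f E] - f [X, E] = (X f) E, and pairing
with a unit field E isolates X f. -/
lemma FieldSmoothNear.dirDeriv (hX : FieldSmoothNear X x) (hf : SmoothNear n f x) :
    SmoothNear n (dirDeriv X f) x := by
  cases n with
  -- In dimension zero there is no unit field, but every vector vanishes.
  | zero =>
    refine (smoothNear_const 0).congr (Eventually.of_forall fun y => ?_)
    have : X y = 0 := Subsingleton.elim (α := EuclideanSpace ℝ (Fin 0)) _ _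
    simp [AlmostSoliton.dirDeriv, this]
  | succ m =>
    obtain ⟨E, hE⟩ := exists_isOrthonormalFrameNear (n := m + 1) x
    have hs := hE.smooth 0
    refine SmoothNear.congr (((hX.mlieBracket (.smul hf hs)).sub
      (.smul hf (hX.mlieBracket hs))).innerField hs) ?_
    filter_upwards [hs.eventually, hf.eventually, hE.orthonormal] with y h1 h2 h3
    have : inner ℝ (E 0 y) (E 0 y) = (1 : ℝ) := by
      rw [real_inner_self_eq_norm_sq, h3.1 0, one_pow]
    simp only [AlmostSoliton.innerField, Pi.sub_apply, mlieBracket_smul_right' h2 h1]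
    rw [Pi.smul_apply', add_sub_cancel_right, real_inner_smul_left, this, mul_one]

/-- The Jacobi identity for X, Y and f E, minus f times the one for X, Y and E, leaves the claimed
identity multiplied by the nonvanishing field E. -/
lemma dirDeriv_mlieBracket (hX : FieldSmoothNear X x) (hY : FieldSmoothNear Y x)
    (hf : SmoothNear n f x) : dirDeriv (mlieBracket (𝓡 n) X Y) f x
      = dirDeriv X (dirDeriv Y f) x - dirDeriv Y (dirDeriv X f) x := by
  cases n with
  | zero =>
    have (V : Π y : M, TangentSpace (𝓡 0) y) (y : M) : V y = 0 :=
      Subsingleton.elim (α := EuclideanSpace ℝ (Fin 0)) _ _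
    simp [AlmostSoliton.dirDeriv, this]
  | succ m =>
    obtain ⟨E, hE⟩ := exists_isOrthonormalFrameNear (n := m + 1) x
    have hs := hE.smooth 0
    have key {V W : Π y : M, TangentSpace (𝓡 (m + 1)) y} (hV : FieldSmoothNear V x)
        (hW : FieldSmoothNear W x) :
        mlieBracket (𝓡 (m + 1)) V (mlieBracket (𝓡 (m + 1)) W (f • E 0)) x
          = (dirDeriv V (dirDeriv W f) x • E 0 x
            + dirDeriv W f x • mlieBracket (𝓡 (m + 1)) V (E 0) x)
            + (dirDeriv V f x • mlieBracket (𝓡 (m + 1)) W (E 0) x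
            + f x • mlieBracket (𝓡 (m + 1)) V (mlieBracket (𝓡 (m + 1)) W (E 0)) x) := by
      have : mlieBracket (𝓡 (m + 1)) W (f • E 0)
          =ᶠ[𝓝 x] dirDeriv W f • E 0 + f • mlieBracket (𝓡 (m + 1)) W (E 0) := by
        filter_upwards [hs.eventually, hf.eventually] with y h1 h2
          using mlieBracket_smul_right' h2 h1
      rw [EventuallyEq.rfl.mlieBracket_vectorField_eq this, mlieBracket_add_right'
        (.smul (hW.dirDeriv hf) hs) (.smul hf (hW.mlieBracket hs)),
        mlieBracket_smul_right' (hW.dirDeriv hf) hs,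
        mlieBracket_smul_right' hf (hW.mlieBracket hs)]
    have hj := mlieBracket_jacobi hX hY (FieldSmoothNear.smul hf hs)
    rw [key hX hY, key hY hX, mlieBracket_smul_right' hf hs, mlieBracket_jacobi hX hY hs] at hj
    have hz : (dirDeriv (mlieBracket (𝓡 (m + 1)) X Y) f x
        - (dirDeriv X (dirDeriv Y f) x - dirDeriv Y (dirDeriv X f) x)) • E 0 x = 0 := by
      rw [smul_add] at hj
      linear_combination (norm := module) (-1 : ℝ) • hj
    rcases smul_eq_zero.1 hz with h | h
    · exact sub_eq_zero.1 h
    · exact absurd h (hE.orthonormal.self_of_nhds.ne_zero 0)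

/-- An operation on vector fields which is linear over the germs of smooth functions at `x`. -/
structure TensorialNear {A : Type*} [AddCommGroup A] [Module ℝ A]
    (Φ : (Π y : M, TangentSpace (𝓡 n) y) → A) (x : M) : Prop where
  smul : ∀ {f : M → ℝ} {X : Π y : M, TangentSpace (𝓡 n) y}, SmoothNear n f x →
    FieldSmoothNear X x → Φ (f • X) = f x • Φ X
  add : ∀ {X Y : Π y : M, TangentSpace (𝓡 n) y}, FieldSmoothNear X x →
    FieldSmoothNear Y x → Φ (X + Y) = Φ X + Φ Y

namespace TensorialNear

variable {A : Type*} [AddCommGroup A] [Module ℝ A] {Φ : (Π y : M, TangentSpace (𝓡 n) y) → A}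

omit [RiemannianBundle (fun x : M => TangentSpace (𝓡 n) x)]
  [IsContMDiffRiemannianBundle (𝓡 n) ∞ (EuclideanSpace ℝ (Fin n))
      (fun x : M => TangentSpace (𝓡 n) x)] in
lemma congr_germ (hΦ : TensorialNear Φ x) (hX : FieldSmoothNear X x) (hY : FieldSmoothNear Y x)
    (h : X =ᶠ[𝓝 x] Y) : Φ X = Φ Y := by
  classical
  -- This cutoff equals 1 near `x`, hence is smooth there, and ψ X = ψ Y holds on all of M. Its
  -- behaviour away from `x` is irrelevant, so no bump function is needed.
  let ψ (y : M) : ℝ := if X y = Y y then 1 else 0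
  have hψ1 : ψ =ᶠ[𝓝 x] fun _ => 1 := h.mono fun y hy => by simp [ψ, hy]
  have hψ : SmoothNear n ψ x := (smoothNear_const 1).congr hψ1
  have he : ψ • X = ψ • Y := by
    funext y
    by_cases hy : X y = Y y <;> simp [ψ, hy]
  have := hΦ.smul hψ hX
  rw [he, hΦ.smul hψ hY, hψ1.self_of_nhds, one_smul, one_smul] at this
  exact this.symm

omit [RiemannianBundle (fun x : M => TangentSpace (𝓡 n) x)]
  [IsContMDiffRiemannianBundle (𝓡 n) ∞ (EuclideanSpace ℝ (Fin n))
      (fun x : M => TangentSpace (𝓡 n) x)] in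
lemma sum (hΦ : TensorialNear Φ x) {ι : Type*} {s : Finset ι}
    {X : ι → Π y : M, TangentSpace (𝓡 n) y} (hX : ∀ i ∈ s, FieldSmoothNear (X i) x) :
    Φ (fun y => ∑ i ∈ s, X i y) = ∑ i ∈ s, Φ (X i) := by
  classical
  induction s using Finset.induction_on with
  | empty =>
    -- The empty sum is handled by homogeneity with the factor 0.
    have h0 : FieldSmoothNear (fun y : M => ∑ i ∈ (∅ : Finset ι), X i y) x := .sum (by simp)
    have h := hΦ.smul (smoothNear_const 0) h0
    rw [zero_smul] at h
    rw [Finset.sum_empty, ← h]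
    congr 1
    funext y
    simp
  | insert a s ha ih =>
    simp only [Finset.sum_insert ha]
    rw [← ih fun i hi => hX i (Finset.mem_insert_of_mem hi)]
    exact hΦ.add (hX a (Finset.mem_insert_self a s))
      (.sum fun i hi => hX i (Finset.mem_insert_of_mem hi))

lemma eq_sum (hΦ : TensorialNear Φ x) {E : Fin n → Π y : M, TangentSpace (𝓡 n) y}
    (hE : IsOrthonormalFrameNear E x) (hX : FieldSmoothNear X x) :
    Φ X = ∑ i, (inner ℝ (E i x) (X x) : ℝ) • Φ (E i) := by
  have hs (i : Fin n) : FieldSmoothNear (innerField (E i) X • E i) x :=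
    .smul ((hE.smooth i).innerField hX) (hE.smooth i)
  rw [hΦ.congr_germ hX (.sum fun i _ => hs i) (hE.eventuallyEq_sum X), hΦ.sum fun i _ => hs i]
  exact Finset.sum_congr rfl fun i _ =>
    hΦ.smul ((hE.smooth i).innerField hX) (hE.smooth i)

lemma congr_value (hΦ : TensorialNear Φ x) (hX : FieldSmoothNear X x) (hY : FieldSmoothNear Y x)
    (h : X x = Y x) : Φ X = Φ Y := by
  obtain ⟨E, hE⟩ := exists_isOrthonormalFrameNear (n := n) x
  rw [hΦ.eq_sum hE hX, hΦ.eq_sum hE hY, h]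

/-- The linear map on the tangent space at `x` induced by an operation tensorial at `x`. -/
def toLin (hΦ : TensorialNear Φ x) : TangentSpace (𝓡 n) x →ₗ[ℝ] A where
  toFun v := Φ (localExt v)
  map_add' v w := by
    have hv := fieldSmoothNear_localExt v
    have hw := fieldSmoothNear_localExt w
    rw [← hΦ.add hv hw]
    exact hΦ.congr_value (fieldSmoothNear_localExt _) (hv.add hw) (by simp)
  map_smul' c v := by
    have hv := fieldSmoothNear_localExt v
    have hc : SmoothNear n (fun _ : M => c) x := smoothNear_const c
    have := hΦ.smul hc hv
    rw [RingHom.id_apply, ← this]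
    exact hΦ.congr_value (fieldSmoothNear_localExt _) (.smul hc hv) (by simp)

lemma toLin_apply (hΦ : TensorialNear Φ x) (hX : FieldSmoothNear X x) :
    hΦ.toLin (X x) = Φ X :=
  hΦ.congr_value (fieldSmoothNear_localExt _) hX (by simp)

end TensorialNear

/-- The terms (X f)⟨Y, Z⟩ and (Y f)⟨X, Z⟩ from the derivatives of inner products cancel against
those from the brackets. -/
lemma koszul_smul_right (hX : FieldSmoothNear X x) (hY : FieldSmoothNear Y x)
    (hZ : FieldSmoothNear Z x) (hf : SmoothNear n f x) :
    koszul X Y (f • Z) x = f x * koszul X Y Z x := by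
  simp only [koszul_eq, innerField_smul_right, dirDeriv_mul hf (hY.innerField hZ),
    dirDeriv_mul hf (hX.innerField hZ), dirDeriv_smul_field, mlieBracket_smul_right' hf hZ,
    inner_add_left, real_inner_smul_left, Pi.smul_apply', real_inner_smul_right]
  simp only [innerField, real_inner_comm]
  ring

lemma koszul_add_right (hX : FieldSmoothNear X x) (hY : FieldSmoothNear Y x)
    (hZ : FieldSmoothNear Z x) (hZ' : FieldSmoothNear Z' x) :
    koszul X Y (Z + Z') x = koszul X Y Z x + koszul X Y Z' x := by
  simp only [koszul_eq, innerField_add_right, dirDeriv_add (hY.innerField hZ) (hY.innerField hZ'),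
    dirDeriv_add (hX.innerField hZ) (hX.innerField hZ'), dirDeriv_add_field,
    mlieBracket_add_right' hZ hZ', inner_add_left, Pi.add_apply, inner_add_right]
  ring

lemma koszul_smul_left (hX : FieldSmoothNear X x) (hY : FieldSmoothNear Y x)
    (hZ : FieldSmoothNear Z x) (hf : SmoothNear n f x) :
    koszul (f • X) Y Z x = f x * koszul X Y Z x := by
  simp only [koszul_eq, innerField_smul_left, dirDeriv_mul hf (hX.innerField hY),
    dirDeriv_mul hf (hX.innerField hZ), dirDeriv_smul_field, mlieBracket_smul_left' hf hX,
    inner_add_left, real_inner_smul_left, Pi.smul_apply', real_inner_smul_right]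
  simp only [innerField, real_inner_comm]
  ring

lemma koszul_add_left (hX : FieldSmoothNear X x) (hX' : FieldSmoothNear X' x)
    (hY : FieldSmoothNear Y x) (hZ : FieldSmoothNear Z x) :
    koszul (X + X') Y Z x = koszul X Y Z x + koszul X' Y Z x := by
  simp only [koszul_eq, innerField_add_left, dirDeriv_add (hX.innerField hZ) (hX'.innerField hZ),
    dirDeriv_add (hX.innerField hY) (hX'.innerField hY), dirDeriv_add_field,
    mlieBracket_add_left' hX hX', inner_add_left, Pi.add_apply, inner_add_right]
  ring

/-- In this slot the derivatives of f along X reinforce each other; after halving they give the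
Leibniz term of the connection. -/
lemma koszul_smul_middle (hX : FieldSmoothNear X x) (hY : FieldSmoothNear Y x)
    (hZ : FieldSmoothNear Z x) (hf : SmoothNear n f x) :
    koszul X (f • Y) Z x = f x * koszul X Y Z x + 2 * dirDeriv X f x * inner ℝ (Y x) (Z x) := by
  simp only [koszul_eq, innerField_smul_left, innerField_smul_right,
    dirDeriv_mul hf (hX.innerField hY),
    dirDeriv_mul hf (hY.innerField hZ), dirDeriv_smul_field, mlieBracket_smul_left' hf hY,
    mlieBracket_smul_right' hf hY,
    inner_add_left, real_inner_smul_left, Pi.smul_apply', real_inner_smul_right]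
  simp only [innerField, real_inner_comm]
  ring

lemma koszul_add_middle (hX : FieldSmoothNear X x) (hY : FieldSmoothNear Y x)
    (hY' : FieldSmoothNear Y' x) (hZ : FieldSmoothNear Z x) :
    koszul X (Y + Y') Z x = koszul X Y Z x + koszul X Y' Z x := by
  simp only [koszul_eq, innerField_add_left, innerField_add_right,
    dirDeriv_add (hY.innerField hZ) (hY'.innerField hZ),
    dirDeriv_add (hX.innerField hY) (hX.innerField hY'), dirDeriv_add_field,
    mlieBracket_add_left' hY hY', mlieBracket_add_right' hY hY', inner_add_left, Pi.add_apply,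
    inner_add_right]
  ring

lemma tensorialNear_koszul (hX : FieldSmoothNear X x) (hY : FieldSmoothNear Y x) :
    TensorialNear (fun Z => koszul X Y Z x) x where
  smul hf hZ := koszul_smul_right hX hY hZ hf
  add hZ hZ' := koszul_add_right hX hY hZ hZ'

lemma SmoothNear.koszul (hX : FieldSmoothNear X x) (hY : FieldSmoothNear Y x)
    (hZ : FieldSmoothNear Z x) : SmoothNear n (koszul X Y Z) x :=
  (((((hX.dirDeriv (hY.innerField hZ)).add (hY.dirDeriv (hX.innerField hZ))).sub
    (hZ.dirDeriv (hX.innerField hY))).add ((hX.mlieBracket hY).innerField hZ)).sub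
    ((hX.mlieBracket hZ).innerField hY)).sub ((hY.mlieBracket hZ).innerField hX)

end

section

variable {n : ℕ} {M : Type*} [TopologicalSpace M] [ChartedSpace (EuclideanSpace ℝ (Fin n)) M]
  [IsManifold (𝓡 n) ∞ M] [RiemannianBundle (fun x : M => TangentSpace (𝓡 n) x)]
  [IsContMDiffRiemannianBundle (𝓡 n) ∞ (EuclideanSpace ℝ (Fin n))
      (fun x : M => TangentSpace (𝓡 n) x)]
variable {f g : M → ℝ} {x : M} {W X X' Y Y' Z Z' T : Π y : M, TangentSpace (𝓡 n) y}

/-! ### The Levi-Civita connection. -/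

section Connection

/-- `nabla` tests the Koszul form only on extended basis vectors; tensoriality in Z carries the
formula to every smooth Z. The algebra of the connection is derived from this. -/
lemma inner_nabla (hX : FieldSmoothNear X x) (hY : FieldSmoothNear Y x)
    (hZ : FieldSmoothNear Z x) : inner ℝ (nabla X Y x) (Z x) = koszul X Y Z x / 2 := by
  have h := tensorialNear_koszul hX hY
  have := inner_sum_smul_eq (stdOrthonormalBasis ℝ (TangentSpace (𝓡 n) x))
    ((2⁻¹ : ℝ) • h.toLin) (Z x)
  rw [LinearMap.smul_apply, h.toLin_apply hZ, smul_eq_mul, inv_mul_eq_div] at this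
  rw [← this]
  simp only [nabla, LinearMap.smul_apply, smul_eq_mul, inv_mul_eq_div]
  rfl

omit [IsContMDiffRiemannianBundle (𝓡 n) ∞ (EuclideanSpace ℝ (Fin n))
      (fun x : M => TangentSpace (𝓡 n) x)] in
lemma eq_of_inner_field_eq {u v : TangentSpace (𝓡 n) x}
    (h : ∀ Z : Π y : M, TangentSpace (𝓡 n) y, FieldSmoothNear Z x →
      (inner ℝ u (Z x) : ℝ) = inner ℝ v (Z x)) : u = v := by
  refine ext_inner_right ℝ fun w => ?_
  simpa using h _ (fieldSmoothNear_localExt w)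

lemma FieldSmoothNear.nabla (hX : FieldSmoothNear X x) (hY : FieldSmoothNear Y x) :
    FieldSmoothNear (nabla X Y) x := by
  obtain ⟨E, hE⟩ := exists_isOrthonormalFrameNear (n := n) x
  have hs (i : Fin n) : FieldSmoothNear
      (((fun _ => (2⁻¹ : ℝ)) * koszul X Y (E i)) • E i) x :=
    .smul ((smoothNear_const _).mul (.koszul hX hY (hE.smooth i))) (hE.smooth i)
  refine (FieldSmoothNear.sum fun i (_ : i ∈ Finset.univ) => hs i).congr ?_
  filter_upwards [hE.eventuallyEq_sum (AlmostSoliton.nabla X Y), hE.eventually, hX.eventually,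
    hY.eventually] with y h1 h2 h3 h4
  refine h1.trans (Finset.sum_congr rfl fun i _ => ?_)
  rw [Pi.smul_apply', Pi.smul_apply', innerField_comm, AlmostSoliton.innerField, inner_nabla h3 h4 (h2.smooth i),
    Pi.mul_apply, inv_mul_eq_div]

lemma nabla_smul_left (hX : FieldSmoothNear X x) (hY : FieldSmoothNear Y x)
    (hf : SmoothNear n f x) : nabla (f • X) Y x = f x • nabla X Y x := by
  refine eq_of_inner_field_eq fun Z hZ => ?_
  rw [inner_nabla (.smul hf hX) hY hZ, koszul_smul_left hX hY hZ hf, real_inner_smul_left,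
    inner_nabla hX hY hZ]
  ring

lemma nabla_add_left (hX : FieldSmoothNear X x) (hX' : FieldSmoothNear X' x)
    (hY : FieldSmoothNear Y x) : nabla (X + X') Y x = nabla X Y x + nabla X' Y x := by
  refine eq_of_inner_field_eq fun Z hZ => ?_
  rw [inner_nabla (hX.add hX') hY hZ, koszul_add_left hX hX' hY hZ, inner_add_left,
    inner_nabla hX hY hZ, inner_nabla hX' hY hZ]
  ring

lemma nabla_smul_right (hX : FieldSmoothNear X x) (hY : FieldSmoothNear Y x)
    (hf : SmoothNear n f x) :
    nabla X (f • Y) x = dirDeriv X f x • Y x + f x • nabla X Y x := by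
  refine eq_of_inner_field_eq fun Z hZ => ?_
  rw [inner_nabla hX (.smul hf hY) hZ, koszul_smul_middle hX hY hZ hf, inner_add_left,
    real_inner_smul_left, real_inner_smul_left, inner_nabla hX hY hZ]
  ring

lemma nabla_add_right (hX : FieldSmoothNear X x) (hY : FieldSmoothNear Y x)
    (hY' : FieldSmoothNear Y' x) : nabla X (Y + Y') x = nabla X Y x + nabla X Y' x := by
  refine eq_of_inner_field_eq fun Z hZ => ?_
  rw [inner_nabla hX (hY.add hY') hZ, koszul_add_middle hX hY hY' hZ, inner_add_left,
    inner_nabla hX hY hZ, inner_nabla hX hY' hZ]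
  ring

lemma nabla_sub_right (hX : FieldSmoothNear X x) (hY : FieldSmoothNear Y x)
    (hY' : FieldSmoothNear Y' x) : nabla X (Y - Y') x = nabla X Y x - nabla X Y' x := by
  have hc : SmoothNear n (fun _ : M => (-1 : ℝ)) x := smoothNear_const _
  have : Y - Y' = Y + (fun _ : M => (-1 : ℝ)) • Y' := by
    funext y
    simp [sub_eq_add_neg]
  rw [this, nabla_add_right hX hY (.smul hc hY'), nabla_smul_right hX hY' hc,
    dirDeriv_const]
  module

lemma tensorialNear_nabla (hY : FieldSmoothNear Y x) :
    TensorialNear (fun X => nabla X Y x) x where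
  smul hf hX := nabla_smul_left hX hY hf
  add hX hX' := nabla_add_left hX hX' hY

lemma nabla_congr_left (hX : FieldSmoothNear X x) (hX' : FieldSmoothNear X' x)
    (hY : FieldSmoothNear Y x) (h : X x = X' x) : nabla X Y x = nabla X' Y x :=
  (tensorialNear_nabla hY).congr_value hX hX' h

/-- This slot is differentiated, so agreement at `x` alone would not suffice. The lemma lets
identities valid near `x` be substituted under an outer derivative. -/
lemma nabla_congr_right (hX : FieldSmoothNear X x) (hY : FieldSmoothNear Y x)
    (h : Y' =ᶠ[𝓝 x] Y) : nabla X Y' x = nabla X Y x := by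
  refine eq_of_inner_field_eq fun Z hZ => ?_
  rw [inner_nabla hX hY hZ, inner_nabla hX (hY.congr h) hZ, koszul_eq, koszul_eq,
    (EventuallyEq.refl (𝓝 x) X).mlieBracket_vectorField_eq h,
    h.mlieBracket_vectorField_eq (EventuallyEq.refl (𝓝 x) Z),
    dirDeriv_congr_field h.self_of_nhds, h.self_of_nhds,
    dirDeriv_congr (f := innerField Y' Z) (g := innerField Y Z)
      (h.mono fun y hy => by simp [innerField, hy]),
    dirDeriv_congr (f := innerField X Y') (g := innerField X Y)
      (h.mono fun y hy => by simp [innerField, hy])]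

/-- Metric compatibility: in koszul X Y Z + koszul X Z Y everything but 2 X⟨Y, Z⟩ cancels. -/
lemma dirDeriv_innerField (hX : FieldSmoothNear X x) (hY : FieldSmoothNear Y x)
    (hZ : FieldSmoothNear Z x) : dirDeriv X (innerField Y Z) x
      = inner ℝ (nabla X Y x) (Z x) + inner ℝ (nabla X Z x) (Y x) := by
  rw [inner_nabla hX hY hZ, inner_nabla hX hZ hY, koszul_eq, koszul_eq,
    innerField_comm (X := Z) (Y := Y), mlieBracket_swap_apply (V := Z), inner_neg_left]
  ring

/-- Vanishing torsion: the part of the Koszul form antisymmetric in X and Y is 2⟨[X, Y], Z⟩. -/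
lemma nabla_sub_nabla_swap (hX : FieldSmoothNear X x) (hY : FieldSmoothNear Y x) :
    nabla X Y x - nabla Y X x = mlieBracket (𝓡 n) X Y x := by
  refine eq_of_inner_field_eq fun Z hZ => ?_
  rw [inner_sub_left, inner_nabla hX hY hZ, inner_nabla hY hX hZ, koszul_eq, koszul_eq,
    innerField_comm (X := Y) (Y := X), mlieBracket_swap_apply (V := Y) (W := X), inner_neg_left]
  ring

end Connection

/-! ### Symmetries of the curvature and the second Bianchi identity. -/

section Curvature

lemma FieldSmoothNear.riem (hX : FieldSmoothNear X x) (hY : FieldSmoothNear Y x)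
    (hZ : FieldSmoothNear Z x) : FieldSmoothNear (riem X Y Z) x :=
  ((hX.nabla (hY.nabla hZ)).sub (hY.nabla (hX.nabla hZ))).sub ((hX.mlieBracket hY).nabla hZ)

lemma riem_swap (hX : FieldSmoothNear X x) (hY : FieldSmoothNear Y x)
    (hZ : FieldSmoothNear Z x) : riem X Y Z x = -riem Y X Z x := by
  have hc : SmoothNear n (fun _ : M => (-1 : ℝ)) x := smoothNear_const _
  have h := nabla_congr_left (hX.mlieBracket hY)
    (FieldSmoothNear.smul hc (hY.mlieBracket hX)) hZ
    (by simpa using mlieBracket_swap_apply (V := X) (W := Y))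
  rw [nabla_smul_left (hY.mlieBracket hX) hZ hc] at h
  simp only [riem, h]
  module

lemma tensorialNear_riem_left (hY : FieldSmoothNear Y x) (hZ : FieldSmoothNear Z x) :
    TensorialNear (fun X => riem X Y Z x) x where
  smul {f X} hf hX := by
    have h1 : nabla (f • X) Z =ᶠ[𝓝 x] f • nabla X Z := by
      filter_upwards [hf.eventually, hX.eventually, hZ.eventually] with y h1 h2 h3
        using nabla_smul_left h2 h3 h1
    have hd := (hY.dirDeriv hf).neg
    have h2 := nabla_congr_left (((FieldSmoothNear.smul hf hX).mlieBracket hY))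
      ((FieldSmoothNear.smul hd hX).add (.smul hf (hX.mlieBracket hY))) hZ
      (mlieBracket_smul_left' hf hX)
    simp only [riem, nabla_congr_right hY (.smul hf (hX.nabla hZ)) h1, h2]
    rw [nabla_add_left (.smul hd hX) (.smul hf (hX.mlieBracket hY)) hZ, nabla_smul_left hX hZ hd,
      nabla_smul_left (hX.mlieBracket hY) hZ hf, nabla_smul_right hY (hX.nabla hZ) hf,
      nabla_smul_left hX (hY.nabla hZ) hf, Pi.neg_apply]
    module
  add {X X'} hX hX' := by
    have h1 : nabla (X + X') Z =ᶠ[𝓝 x] nabla X Z + nabla X' Z := by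
      filter_upwards [hX.eventually, hX'.eventually, hZ.eventually] with y h1 h2 h3
        using nabla_add_left h1 h2 h3
    have h2 := nabla_congr_left (((hX.add hX').mlieBracket hY))
      ((hX.mlieBracket hY).add (hX'.mlieBracket hY)) hZ (mlieBracket_add_left' hX hX')
    simp only [riem, nabla_congr_right hY ((hX.nabla hZ).add (hX'.nabla hZ)) h1, h2]
    rw [nabla_add_left (hX.mlieBracket hY) (hX'.mlieBracket hY) hZ,
      nabla_add_right hY (hX.nabla hZ) (hX'.nabla hZ), nabla_add_left hX hX' (hY.nabla hZ)]
    module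

lemma tensorialNear_riem_middle (hX : FieldSmoothNear X x) (hZ : FieldSmoothNear Z x) :
    TensorialNear (fun Y => riem X Y Z x) x where
  smul {f Y} hf hY := by
    simp only [riem_swap hX (.smul hf hY) hZ, (tensorialNear_riem_left hX hZ).smul hf hY,
      riem_swap hX hY hZ, smul_neg]
  add {Y Y'} hY hY' := by
    simp only [riem_swap hX (hY.add hY') hZ, (tensorialNear_riem_left hX hZ).add hY hY',
      riem_swap hX hY hZ, riem_swap hX hY' hZ, neg_add]

/-- First-order cross terms are symmetric in X and Y, and the second derivatives of f cancel against
the bracket term by `dirDeriv_mlieBracket`. -/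
lemma tensorialNear_riem_right (hX : FieldSmoothNear X x) (hY : FieldSmoothNear Y x) :
    TensorialNear (fun Z => riem X Y Z x) x where
  smul {f Z} hf hZ := by
    have key {V W : Π y : M, TangentSpace (𝓡 n) y} (hV : FieldSmoothNear V x)
        (hW : FieldSmoothNear W x) : nabla V (nabla W (f • Z)) x
          = (dirDeriv V (dirDeriv W f) x • Z x + dirDeriv W f x • nabla V Z x)
            + (dirDeriv V f x • nabla W Z x + f x • nabla V (nabla W Z) x) := by
      have h : nabla W (f • Z) =ᶠ[𝓝 x] dirDeriv W f • Z + f • nabla W Z := by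
        filter_upwards [hf.eventually, hW.eventually, hZ.eventually] with y h1 h2 h3
          using nabla_smul_right h2 h3 h1
      have hd := hW.dirDeriv hf
      have hn := hW.nabla hZ
      rw [nabla_congr_right hV ((FieldSmoothNear.smul hd hZ).add (.smul hf hn)) h,
        nabla_add_right hV (.smul hd hZ) (.smul hf hn), nabla_smul_right hV hZ hd,
        nabla_smul_right hV hn hf]
    simp only [riem, key hX hY, key hY hX, nabla_smul_right (hX.mlieBracket hY) hZ hf,
      dirDeriv_mlieBracket hX hY hf]
    module
  add {Z Z'} hZ hZ' := by
    have key {V W : Π y : M, TangentSpace (𝓡 n) y} (hV : FieldSmoothNear V x)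
        (hW : FieldSmoothNear W x) : nabla V (nabla W (Z + Z')) x
          = nabla V (nabla W Z) x + nabla V (nabla W Z') x := by
      have h : nabla W (Z + Z') =ᶠ[𝓝 x] nabla W Z + nabla W Z' := by
        filter_upwards [hW.eventually, hZ.eventually, hZ'.eventually] with y h1 h2 h3
          using nabla_add_right h1 h2 h3
      rw [nabla_congr_right hV ((hW.nabla hZ).add (hW.nabla hZ')) h,
        nabla_add_right hV (hW.nabla hZ) (hW.nabla hZ')]
    simp only [riem, key hX hY, key hY hX, nabla_add_right (hX.mlieBracket hY) hZ hZ']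
    module

/-- Apply X Y - Y X - [X, Y] = 0 to ⟨Z, T⟩: the products of first derivatives are symmetric in X and
Y and drop out. -/
lemma inner_riem_swap (hX : FieldSmoothNear X x) (hY : FieldSmoothNear Y x)
    (hZ : FieldSmoothNear Z x) (hT : FieldSmoothNear T x) :
    inner ℝ (riem X Y Z x) (T x) = -inner ℝ (riem X Y T x) (Z x) := by
  have key {V W : Π y : M, TangentSpace (𝓡 n) y} (hV : FieldSmoothNear V x)
      (hW : FieldSmoothNear W x) : dirDeriv V (dirDeriv W (innerField Z T)) x
        = (inner ℝ (nabla V (nabla W Z) x) (T x) + inner ℝ (nabla V T x) (nabla W Z x))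
          + (inner ℝ (nabla V (nabla W T) x) (Z x) + inner ℝ (nabla V Z x) (nabla W T x)) := by
    have h : dirDeriv W (innerField Z T)
        =ᶠ[𝓝 x] innerField (nabla W Z) T + innerField (nabla W T) Z := by
      filter_upwards [hW.eventually, hZ.eventually, hT.eventually] with y h1 h2 h3
        using dirDeriv_innerField h1 h2 h3
    have hWZ := hW.nabla hZ
    have hWT := hW.nabla hT
    rw [dirDeriv_congr h, dirDeriv_add (hWZ.innerField hT) (hWT.innerField hZ),
      dirDeriv_innerField hV hWZ hT, dirDeriv_innerField hV hWT hZ]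
  have h := dirDeriv_mlieBracket hX hY (hZ.innerField hT)
  rw [dirDeriv_innerField (hX.mlieBracket hY) hZ hT, key hX hY, key hY hX] at h
  simp only [riem, inner_sub_left]
  rw [real_inner_comm (nabla Y Z x) (nabla X T x), real_inner_comm (nabla X Z x) (nabla Y T x)] at h
  linarith

/-- The covariant derivative `(∇_W R)(X,Y)Z`. -/
def covRiem (W X Y Z : Π y : M, TangentSpace (𝓡 n) y) (x : M) : TangentSpace (𝓡 n) x :=
  nabla W (riem X Y Z) x - riem (nabla W X) Y Z x - riem X (nabla W Y) Z x - riem X Y (nabla W Z) x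

lemma covRiem_swap (hW : FieldSmoothNear W x) (hX : FieldSmoothNear X x)
    (hY : FieldSmoothNear Y x) (hZ : FieldSmoothNear Z x) :
    covRiem W X Y Z x = -covRiem W Y X Z x := by
  have hc : SmoothNear n (fun _ : M => (-1 : ℝ)) x := smoothNear_const _
  have h : riem X Y Z =ᶠ[𝓝 x] (fun _ : M => (-1 : ℝ)) • riem Y X Z := by
    filter_upwards [hX.eventually, hY.eventually, hZ.eventually] with y h1 h2 h3
    exact (riem_swap h1 h2 h3).trans (neg_one_smul ℝ _).symm
  have hR := hY.riem hX hZ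
  simp only [covRiem]
  rw [nabla_congr_right hW (.smul hc hR) h, nabla_smul_right hW hR hc, dirDeriv_const,
    riem_swap (hW.nabla hX) hY hZ, riem_swap hX (hW.nabla hY) hZ, riem_swap hX hY (hW.nabla hZ)]
  module

lemma inner_covRiem_swap (hW : FieldSmoothNear W x) (hX : FieldSmoothNear X x)
    (hY : FieldSmoothNear Y x) (hZ : FieldSmoothNear Z x) (hT : FieldSmoothNear T x) :
    inner ℝ (covRiem W X Y Z x) (T x) = -inner ℝ (covRiem W X Y T x) (Z x) := by
  have h : innerField (riem X Y Z) T + innerField (riem X Y T) Z =ᶠ[𝓝 x] fun _ => 0 := by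
    filter_upwards [hX.eventually, hY.eventually, hZ.eventually, hT.eventually] with y h1 h2 h3 h4
    simp [innerField, inner_riem_swap h1 h2 h3 h4]
  have hRZ := hX.riem hY hZ
  have hRT := hX.riem hY hT
  have h := dirDeriv_congr (X := W) h
  rw [dirDeriv_const, dirDeriv_add (hRZ.innerField hT) (hRT.innerField hZ),
    dirDeriv_innerField hW hRZ hT, dirDeriv_innerField hW hRT hZ] at h
  have h1 := inner_riem_swap (hW.nabla hX) hY hZ hT
  have h2 := inner_riem_swap hX (hW.nabla hY) hZ hT
  have h3 := inner_riem_swap hX hY (hW.nabla hZ) hT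
  have h4 := inner_riem_swap hX hY (hW.nabla hT) hZ
  have h5 := real_inner_comm (nabla W T x) (riem X Y Z x)
  have h6 := real_inner_comm (nabla W Z x) (riem X Y T x)
  simp only [covRiem, inner_sub_left]
  linarith

/-- In the cyclic Bianchi sum the corrections in the first two curvature slots pair up in this way
into brackets. -/
lemma riem_nabla_sub_riem_nabla (hX : FieldSmoothNear X x) (hY : FieldSmoothNear Y x)
    (hW : FieldSmoothNear W x) (hZ : FieldSmoothNear Z x) :
    riem (nabla X Y) W Z x + riem W (nabla Y X) Z x = riem (mlieBracket (𝓡 n) X Y) W Z x := by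
  have h := tensorialNear_riem_left hW hZ
  rw [riem_swap hW (hY.nabla hX) hZ, ← h.toLin_apply (hX.nabla hY), ← h.toLin_apply (hY.nabla hX),
    ← h.toLin_apply (hX.mlieBracket hY), ← nabla_sub_nabla_swap hX hY, map_sub, sub_eq_add_neg]

omit [RiemannianBundle (fun x : M => TangentSpace (𝓡 n) x)]
  [IsContMDiffRiemannianBundle (𝓡 n) ∞ (EuclideanSpace ℝ (Fin n))
      (fun x : M => TangentSpace (𝓡 n) x)] in
lemma mlieBracket_mlieBracket_swap (hY : FieldSmoothNear Y x)
    (hW : FieldSmoothNear W x) : mlieBracket (𝓡 n) X (mlieBracket (𝓡 n) W Y) x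
      = mlieBracket (𝓡 n) (mlieBracket (𝓡 n) Y W) X x := by
  have h : mlieBracket (𝓡 n) W Y = (fun _ : M => (-1 : ℝ)) • mlieBracket (𝓡 n) Y W := by
    rw [mlieBracket_swap]
    funext y
    simp
  rw [h, mlieBracket_smul_right' (smoothNear_const _) (hY.mlieBracket hW), dirDeriv_const,
    mlieBracket_swap_apply (V := X)]
  module

/-- The second Bianchi identity. -/
lemma second_bianchi (hW : FieldSmoothNear W x) (hX : FieldSmoothNear X x)
    (hY : FieldSmoothNear Y x) (hZ : FieldSmoothNear Z x) :
    covRiem W X Y Z x + covRiem X Y W Z x + covRiem Y W X Z x = 0 := by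
  have key {U V W : Π y : M, TangentSpace (𝓡 n) y} (hU : FieldSmoothNear U x)
      (hV : FieldSmoothNear V x) (hW : FieldSmoothNear W x) : nabla W (riem U V Z) x
        = nabla W (nabla U (nabla V Z)) x - nabla W (nabla V (nabla U Z)) x
          - nabla W (nabla (mlieBracket (𝓡 n) U V) Z) x := by
    have h1 := hU.nabla (hV.nabla hZ)
    have h2 := hV.nabla (hU.nabla hZ)
    have h3 := (hU.mlieBracket hV).nabla hZ
    rw [← nabla_sub_right hW h1 h2, ← nabla_sub_right hW (h1.sub h2) h3]
    rfl
  -- The direction of `nabla` enters linearly through its value at `x`, so the Jacobi identity at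
  -- that point suffices.
  have jac : nabla (mlieBracket (𝓡 n) (mlieBracket (𝓡 n) W X) Y) Z x
      + nabla (mlieBracket (𝓡 n) (mlieBracket (𝓡 n) X Y) W) Z x
      + nabla (mlieBracket (𝓡 n) (mlieBracket (𝓡 n) Y W) X) Z x = 0 := by
    have h := tensorialNear_nabla hZ
    rw [← h.toLin_apply ((hW.mlieBracket hX).mlieBracket hY),
      ← h.toLin_apply ((hX.mlieBracket hY).mlieBracket hW),
      ← h.toLin_apply ((hY.mlieBracket hW).mlieBracket hX), ← map_add, ← map_add]
    refine (congrArg h.toLin ?_).trans (map_zero _)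
    have := mlieBracket_jacobi hW hX hY
    rw [mlieBracket_swap_apply (V := W), mlieBracket_mlieBracket_swap hY hW] at this
    linear_combination (norm := module) (-1 : ℝ) • this
  have e1 := riem_nabla_sub_riem_nabla hW hX hY hZ
  have e2 := riem_nabla_sub_riem_nabla hX hY hW hZ
  have e3 := riem_nabla_sub_riem_nabla hY hW hX hZ
  have r (U V T : Π y : M, TangentSpace (𝓡 n) y) : riem U V T x = nabla U (nabla V T) x
    - nabla V (nabla U T) x - nabla (mlieBracket (𝓡 n) U V) T x := rfl
  rw [r (mlieBracket (𝓡 n) _ _)] at e1 e2 e3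
  simp only [covRiem, key hX hY hW, key hY hW hX, key hW hX hY, r X Y (nabla W Z),
    r Y W (nabla X Z), r W X (nabla Y Z)]
  -- Third derivatives of Z cancel cyclically and mixed bracket terms cancel against `e1`, `e2`,
  -- `e3`; only the double brackets of `jac` remain.
  linear_combination (norm := module) (-1 : ℝ) • e1 + (-1 : ℝ) • e2 + (-1 : ℝ) • e3 + jac

end Curvature

end

section

section LinearAlgebra

variable {V : Type*} [NormedAddCommGroup V] [InnerProductSpace ℝ V] {ι : Type*} [Fintype ι]

/-- The coefficients of d in the basis form a skew matrix, here contracted with the symmetrization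
of B. -/
lemma sum_apply_add_apply_eq_zero (e : OrthonormalBasis ι ℝ V) (B : V →ₗ[ℝ] V →ₗ[ℝ] ℝ) (d : ι → V)
    (hd : ∀ i j, (inner ℝ (d i) (e j) : ℝ) = -inner ℝ (d j) (e i)) :
    ∑ i, (B (d i) (e i) + B (e i) (d i)) = 0 := by
  have h1 (i : ι) : B (d i) (e i) = ∑ j, inner ℝ (d i) (e j) * B (e j) (e i) := by
    have h := congrArg (fun v => B v (e i)) (e.sum_repr' (d i))
    simpa [real_inner_comm] using h.symm
  have h2 (i : ι) : B (e i) (d i) = ∑ j, inner ℝ (d i) (e j) * B (e i) (e j) := by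
    have h := congrArg (fun v => B (e i) v) (e.sum_repr' (d i))
    simpa [real_inner_comm] using h.symm
  rw [Finset.sum_add_distrib]
  simp only [h1, h2]
  rw [Finset.sum_comm, ← Finset.sum_add_distrib]
  refine Finset.sum_eq_zero fun i _ => ?_
  rw [← Finset.sum_add_distrib]
  refine Finset.sum_eq_zero fun j _ => ?_
  rw [hd j i]
  ring

end LinearAlgebra

variable {n : ℕ} {M : Type*} [TopologicalSpace M] [ChartedSpace (EuclideanSpace ℝ (Fin n)) M]
  [IsManifold (𝓡 n) ∞ M] [RiemannianBundle (fun x : M => TangentSpace (𝓡 n) x)]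
  [IsContMDiffRiemannianBundle (𝓡 n) ∞ (EuclideanSpace ℝ (Fin n))
      (fun x : M => TangentSpace (𝓡 n) x)]
variable {f ρ : M → ℝ} {x : M} {U V W G : Π y : M, TangentSpace (𝓡 n) y}
  {E : Fin n → Π y : M, TangentSpace (𝓡 n) y}

lemma IsOrthonormalFrameNear.inner_nabla_swap (hE : IsOrthonormalFrameNear E x)
    (hW : FieldSmoothNear W x) (i j : Fin n) :
    (inner ℝ (nabla W (E i) x) (E j x) : ℝ) = -inner ℝ (nabla W (E j) x) (E i x) := by
  have h : innerField (E i) (E j) =ᶠ[𝓝 x] fun _ => if i = j then (1 : ℝ) else 0 := by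
    filter_upwards [hE.orthonormal] with y hy using orthonormal_iff_ite.1 hy i j
  have h := dirDeriv_congr (X := W) h
  rw [dirDeriv_const, dirDeriv_innerField hW (hE.smooth i) (hE.smooth j)] at h
  linarith

/-- Derivatives of the frame contribute nothing to the derivative of a trace, so no frame parallel
at `x` is needed. -/
lemma IsOrthonormalFrameNear.sum_apply_nabla (hE : IsOrthonormalFrameNear E x)
    (hW : FieldSmoothNear W x) (B : TangentSpace (𝓡 n) x →ₗ[ℝ] TangentSpace (𝓡 n) x →ₗ[ℝ] ℝ) :
    ∑ i, (B (nabla W (E i) x) (E i x) + B (E i x) (nabla W (E i) x)) = 0 := by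
  obtain ⟨b, hb⟩ := hE.exists_basis
  have := sum_apply_add_apply_eq_zero b B (fun i => nabla W (E i) x)
    (by simpa only [hb] using hE.inner_nabla_swap hW)
  simpa only [hb] using this

/-! ### Ricci and scalar curvature in local frames. -/

section Traces

/-- The bilinear form `(w, z) ↦ ⟨R(w,U)V, z⟩` at `x`. -/
def riemForm (hU : FieldSmoothNear U x) (hV : FieldSmoothNear V x) :
    TangentSpace (𝓡 n) x →ₗ[ℝ] TangentSpace (𝓡 n) x →ₗ[ℝ] ℝ :=
  (innerₗ (TangentSpace (𝓡 n) x)).comp (tensorialNear_riem_left hU hV).toLin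

lemma riemForm_apply (hU : FieldSmoothNear U x) (hV : FieldSmoothNear V x)
    (hW : FieldSmoothNear W x) (z : TangentSpace (𝓡 n) x) :
    riemForm hU hV (W x) z = inner ℝ (riem W U V x) z := by
  simp [riemForm, TensorialNear.toLin_apply _ hW]

/-- Since one frame serves all nearby points, this expression can be differentiated, unlike the
pointwise definition. -/
lemma ricci_eq_sum (hE : IsOrthonormalFrameNear E x) (hU : FieldSmoothNear U x)
    (hV : FieldSmoothNear V x) :
    ricci (U x) (V x) = ∑ i, inner ℝ (riem (E i) U V x) (E i x) := by
  obtain ⟨b, hb⟩ := hE.exists_basis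
  have hu := fieldSmoothNear_localExt (U x)
  have hv := fieldSmoothNear_localExt (V x)
  have h := sum_apply_self_eq (stdOrthonormalBasis ℝ (TangentSpace (𝓡 n) x)) b (riemForm hu hv)
  simp only [hb, riemForm_apply hu hv (hE.smooth _)] at h
  have h1 (i : Fin n) : riem (E i) (localExt (U x)) (localExt (V x)) x = riem (E i) U V x := by
    rw [(tensorialNear_riem_middle (hE.smooth i) hv).congr_value hu hU (by simp),
      (tensorialNear_riem_right (hE.smooth i) hU).congr_value hv hV (by simp)]
  simp only [h1] at h
  rw [← h, ricci]
  refine Finset.sum_congr rfl fun i _ => ?_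
  have := riemForm_apply hu hv (fieldSmoothNear_localExt
    (stdOrthonormalBasis ℝ (TangentSpace (𝓡 n) x) i)) (stdOrthonormalBasis ℝ _ i)
  rw [localExt_self] at this
  exact this.symm

/-- The Ricci curvature of two vector fields. -/
def ricField (U V : Π y : M, TangentSpace (𝓡 n) y) (y : M) : ℝ := ricci (U y) (V y)

lemma ricField_eventuallyEq (hE : IsOrthonormalFrameNear E x) (hU : FieldSmoothNear U x)
    (hV : FieldSmoothNear V x) :
    ricField U V =ᶠ[𝓝 x] fun y => ∑ i, innerField (riem (E i) U V) (E i) y := by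
  filter_upwards [hE.eventually, hU.eventually, hV.eventually] with y h1 h2 h3
    using ricci_eq_sum h1 h2 h3

lemma SmoothNear.ricField (hU : FieldSmoothNear U x) (hV : FieldSmoothNear V x) :
    SmoothNear n (ricField U V) x := by
  obtain ⟨E, hE⟩ := exists_isOrthonormalFrameNear (n := n) x
  exact (SmoothNear.sum fun i _ => ((hE.smooth i).riem hU hV).innerField (hE.smooth i)).congr
    (ricField_eventuallyEq hE hU hV)

lemma tensorialNear_ricField_left (hV : FieldSmoothNear V x) :
    TensorialNear (fun U => ricField U V x) x := by
  obtain ⟨E, hE⟩ := exists_isOrthonormalFrameNear (n := n) x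
  have ht (i : Fin n) := tensorialNear_riem_middle (hE.smooth i) hV
  constructor
  · intro f U hf hU
    simp only [ricField]
    rw [ricci_eq_sum hE (.smul hf hU) hV, ricci_eq_sum hE hU hV, smul_eq_mul, Finset.mul_sum]
    exact Finset.sum_congr rfl fun i _ => by rw [(ht i).smul hf hU, real_inner_smul_left]
  · intro U U' hU hU'
    simp only [ricField]
    rw [ricci_eq_sum hE (hU.add hU') hV, ricci_eq_sum hE hU hV, ricci_eq_sum hE hU' hV,
      ← Finset.sum_add_distrib]
    exact Finset.sum_congr rfl fun i _ => by rw [(ht i).add hU hU', inner_add_left]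

lemma tensorialNear_ricField_right (hU : FieldSmoothNear U x) :
    TensorialNear (fun V => ricField U V x) x := by
  obtain ⟨E, hE⟩ := exists_isOrthonormalFrameNear (n := n) x
  have ht (i : Fin n) := tensorialNear_riem_right (hE.smooth i) hU
  constructor
  · intro f V hf hV
    simp only [ricField]
    rw [ricci_eq_sum hE hU (.smul hf hV), ricci_eq_sum hE hU hV, smul_eq_mul, Finset.mul_sum]
    exact Finset.sum_congr rfl fun i _ => by rw [(ht i).smul hf hV, real_inner_smul_left]
  · intro V V' hV hV'
    simp only [ricField]
    rw [ricci_eq_sum hE hU (hV.add hV'), ricci_eq_sum hE hU hV, ricci_eq_sum hE hU hV',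
      ← Finset.sum_add_distrib]
    exact Finset.sum_congr rfl fun i _ => by rw [(ht i).add hV hV', inner_add_left]

lemma tensorialNear_ricField_left_apply (hV : FieldSmoothNear V x) (u : TangentSpace (𝓡 n) x) :
    (tensorialNear_ricField_left hV).toLin u = ricci u (V x) := by
  change ricci (localExt u x) (V x) = _
  rw [localExt_self]

lemma tensorialNear_ricField_right_apply (hU : FieldSmoothNear U x) (v : TangentSpace (𝓡 n) x) :
    (tensorialNear_ricField_right hU).toLin v = ricci (U x) v := by
  change ricci (U x) (localExt v x) = _
  rw [localExt_self]

lemma ricci_add_left (u u' v : TangentSpace (𝓡 n) x) :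
    ricci (u + u') v = ricci u v + ricci u' v := by
  have h := tensorialNear_ricField_left_apply (fieldSmoothNear_localExt v)
  simp only [localExt_self] at h
  rw [← h, ← h, ← h, map_add]

lemma ricci_smul_left (c : ℝ) (u v : TangentSpace (𝓡 n) x) :
    ricci (c • u) v = c • ricci u v := by
  have h := tensorialNear_ricField_left_apply (fieldSmoothNear_localExt v)
  simp only [localExt_self] at h
  rw [← h, ← h, map_smul]

lemma ricci_add_right (u v v' : TangentSpace (𝓡 n) x) :
    ricci u (v + v') = ricci u v + ricci u v' := by
  have h := tensorialNear_ricField_right_apply (fieldSmoothNear_localExt u)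
  simp only [localExt_self] at h
  rw [← h, ← h, ← h, map_add]

lemma ricci_smul_right (c : ℝ) (u v : TangentSpace (𝓡 n) x) :
    ricci u (c • v) = c • ricci u v := by
  have h := tensorialNear_ricField_right_apply (fieldSmoothNear_localExt u)
  simp only [localExt_self] at h
  rw [← h, ← h, map_smul]

/-- The Ricci curvature at `x` as a bilinear form. -/
def ricForm (x : M) : TangentSpace (𝓡 n) x →ₗ[ℝ] TangentSpace (𝓡 n) x →ₗ[ℝ] ℝ :=
  LinearMap.mk₂ ℝ (fun u v => ricci u v) ricci_add_left ricci_smul_left ricci_add_right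
    ricci_smul_right

lemma scal_eq_sum (hE : IsOrthonormalFrameNear E x) :
    scal (n := n) x = ∑ i, ricci (E i x) (E i x) := by
  obtain ⟨b, hb⟩ := hE.exists_basis
  have h := sum_apply_self_eq (stdOrthonormalBasis ℝ (TangentSpace (𝓡 n) x)) b (ricForm x)
  simp only [hb] at h
  exact h

lemma scal_eventuallyEq (hE : IsOrthonormalFrameNear E x) :
    scal (n := n) =ᶠ[𝓝 x] fun y => ∑ i, ricField (E i) (E i) y := by
  filter_upwards [hE.eventually] with y hy using scal_eq_sum hy

lemma smoothNear_scal (x : M) : SmoothNear n (scal (n := n)) x := by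
  obtain ⟨E, hE⟩ := exists_isOrthonormalFrameNear (n := n) x
  exact (SmoothNear.sum fun i _ => .ricField (hE.smooth i) (hE.smooth i)).congr
    (scal_eventuallyEq hE)

end Traces

/-! ### The contracted Bianchi identity. -/

section ContractedBianchi

/-- The covariant derivative `(∇_W Ric)(U,V)`. -/
def covRic (W U V : Π y : M, TangentSpace (𝓡 n) y) (x : M) : ℝ :=
  dirDeriv W (ricField U V) x - ricci (nabla W U x) (V x) - ricci (U x) (nabla W V x)

/-- Covariant differentiation commutes with the trace; the frame derivatives cancel by `h0`. -/
lemma sum_inner_covRiem (hE : IsOrthonormalFrameNear E x) (hW : FieldSmoothNear W x)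
    (hU : FieldSmoothNear U x) (hV : FieldSmoothNear V x) :
    ∑ i, inner ℝ (covRiem W (E i) U V x) (E i x) = covRic W U V x := by
  have hr (i : Fin n) := (hE.smooth i).riem hU hV
  have h0 := hE.sum_apply_nabla hW (riemForm hU hV)
  simp only [riemForm_apply hU hV (hE.smooth _), riemForm_apply hU hV (hW.nabla (hE.smooth _))]
    at h0
  rw [covRic, dirDeriv_congr (ricField_eventuallyEq hE hU hV),
    dirDeriv_sum fun i _ => (hr i).innerField (hE.smooth i), ricci_eq_sum hE (hW.nabla hU) hV,
    ricci_eq_sum hE hU (hW.nabla hV), ← sub_eq_zero, ← neg_eq_zero, ← h0,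
    ← Finset.sum_sub_distrib, ← Finset.sum_sub_distrib, ← Finset.sum_sub_distrib,
    ← Finset.sum_neg_distrib]
  refine Finset.sum_congr rfl fun i _ => ?_
  rw [dirDeriv_innerField hW (hr i) (hE.smooth i), real_inner_comm (nabla W (E i) x), covRiem]
  simp only [inner_sub_left]
  ring

lemma dirDeriv_scal_eq_sum (hE : IsOrthonormalFrameNear E x) (hW : FieldSmoothNear W x) :
    dirDeriv W (scal (n := n)) x = ∑ i, covRic W (E i) (E i) x := by
  have h0 := hE.sum_apply_nabla hW (ricForm x)
  have h0 : ∑ i, (ricci (nabla W (E i) x) (E i x) + ricci (E i x) (nabla W (E i) x)) = 0 := h0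
  rw [dirDeriv_congr (scal_eventuallyEq hE),
    dirDeriv_sum fun i _ => .ricField (hE.smooth i) (hE.smooth i), ← sub_eq_zero, ← h0,
    ← Finset.sum_sub_distrib]
  refine Finset.sum_congr rfl fun i _ => ?_
  rw [covRic]
  ring

/-- The contracted second Bianchi identity `dR = 2 div Ric`. -/
lemma contracted_bianchi (hE : IsOrthonormalFrameNear E x) (hW : FieldSmoothNear W x) :
    dirDeriv W (scal (n := n)) x = 2 * ∑ i, covRic (E i) W (E i) x := by
  have hs := hE.smooth
  -- Second Bianchi for W, E_i, E_j, using skewness in the first pair and in the last pair. Summed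
  -- over i and j, each term on the right is the divergence of Ric.
  have h1 (i j : Fin n) : (inner ℝ (covRiem W (E i) (E j) (E j) x) (E i x) : ℝ)
      = inner ℝ (covRiem (E i) (E j) W (E i) x) (E j x)
        + inner ℝ (covRiem (E j) (E i) W (E j) x) (E i x) := by
    have h := congrArg (fun v => (inner ℝ v (E i x) : ℝ))
      (second_bianchi hW (hs i) (hs j) (hs j))
    simp only [inner_add_left, inner_zero_left] at h
    rw [covRiem_swap (hs j) hW (hs i) (hs j), inner_neg_left,
      inner_covRiem_swap (hs i) (hs j) hW (hs j) (hs i)] at h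
    linarith
  have h2 (i : Fin n) : covRic W (E i) (E i) x
      = ∑ j, inner ℝ (covRiem W (E j) (E i) (E i) x) (E j x) :=
    (sum_inner_covRiem hE hW (hs i) (hs i)).symm
  have h3 (i : Fin n) : covRic (E i) W (E i) x
      = ∑ j, inner ℝ (covRiem (E i) (E j) W (E i) x) (E j x) :=
    (sum_inner_covRiem hE (hs i) hW (hs i)).symm
  rw [dirDeriv_scal_eq_sum hE hW, two_mul, Finset.sum_congr rfl fun i _ => h2 i,
    Finset.sum_congr rfl fun i _ => h3 i]
  conv_lhs => rw [Finset.sum_congr rfl fun i _ => Finset.sum_congr rfl fun j _ => h1 j i]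
  simp only [Finset.sum_add_distrib]
  rw [Finset.sum_comm]

end ContractedBianchi

/-! ### The soliton equation and the differential of the scalar curvature. -/

section Soliton

omit [IsManifold (𝓡 n) ∞ M] [IsContMDiffRiemannianBundle (𝓡 n) ∞ (EuclideanSpace ℝ (Fin n))
  (fun x : M => TangentSpace (𝓡 n) x)] in
lemma inner_grad (f : M → ℝ) (v : TangentSpace (𝓡 n) x) :
    inner ℝ (grad f x) v = mvfderiv (𝓡 n) f x v :=
  inner_sum_smul_eq (stdOrthonormalBasis ℝ (TangentSpace (𝓡 n) x))
    (mvfderiv (𝓡 n) f x).toLinearMap v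

lemma SmoothNear.grad (hf : SmoothNear n f x) : FieldSmoothNear (grad (n := n) f) x := by
  obtain ⟨E, hE⟩ := exists_isOrthonormalFrameNear (n := n) x
  refine (FieldSmoothNear.sum fun i (_ : i ∈ Finset.univ) =>
    .smul ((hE.smooth i).dirDeriv hf) (hE.smooth i)).congr ?_
  filter_upwards [hE.eventuallyEq_sum (AlmostSoliton.grad (n := n) f)] with y h1
  refine h1.trans (Finset.sum_congr rfl fun i _ => ?_)
  rw [Pi.smul_apply', Pi.smul_apply', innerField_comm, AlmostSoliton.innerField, inner_grad]
  rfl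

lemma hess_eq (hU : FieldSmoothNear U x) (hf : SmoothNear n f x) (v : TangentSpace (𝓡 n) x) :
    hess f (U x) v = inner ℝ (nabla U (grad f) x) v := by
  rw [hess, nabla_congr_left (fieldSmoothNear_localExt _) hU hf.grad (by simp)]

/-- The second covariant derivative `∇²_{W,U} G`. -/
def nablaSq (W U G : Π y : M, TangentSpace (𝓡 n) y) (x : M) : TangentSpace (𝓡 n) x :=
  nabla W (nabla U G) x - nabla (nabla W U) G x

/-- The Ricci identity; vanishing torsion turns the difference of first-order corrections into the
bracket term of the curvature. -/
lemma nablaSq_sub_nablaSq_swap (hW : FieldSmoothNear W x) (hU : FieldSmoothNear U x)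
    (hG : FieldSmoothNear G x) : nablaSq W U G x - nablaSq U W G x = riem W U G x := by
  have h := tensorialNear_nabla hG
  have h1 : nabla (mlieBracket (𝓡 n) W U) G x = nabla (nabla W U) G x - nabla (nabla U W) G x := by
    rw [← h.toLin_apply (hW.mlieBracket hU), ← h.toLin_apply (hW.nabla hU),
      ← h.toLin_apply (hU.nabla hW), ← nabla_sub_nabla_swap hW hU, map_sub]
  rw [riem, h1, nablaSq, nablaSq]
  abel

lemma covRic_eq_of_isGradientRicciAlmostSoliton (h : IsGradientRicciAlmostSoliton n f ρ)
    (hW : FieldSmoothNear W x) (hU : FieldSmoothNear U x) (hV : FieldSmoothNear V x) :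
    covRic W U V x
      = dirDeriv W ρ x * inner ℝ (U x) (V x) - inner ℝ (nablaSq W U (grad f) x) (V x) := by
  have hf (y : M) : SmoothNear n f y := Eventually.of_forall h.smooth_potential
  have hρ : SmoothNear n ρ x := Eventually.of_forall h.smooth_soliton
  have hG := (hf x).grad
  -- The point and the field are kept general so that the equation can be differentiated near `x`
  -- and also applied to ∇_W U.
  have key {U : Π y : M, TangentSpace (𝓡 n) y} {y : M} (hU : FieldSmoothNear U y)
      (v : TangentSpace (𝓡 n) y) :
      ricci (U y) v = ρ y * inner ℝ (U y) v - inner ℝ (nabla U (grad f) y) v := by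
    rw [← h.soliton_eq, ← hess_eq hU (hf y)]
    ring
  have h1 : ricField U V =ᶠ[𝓝 x] ρ * innerField U V - innerField (nabla U (grad f)) V := by
    filter_upwards [hU.eventually] with y hy using key hy (V y)
  have hUV := hU.innerField hV
  have hUG := hU.nabla hG
  rw [covRic, dirDeriv_congr h1, dirDeriv_sub (hρ.mul hUV) (hUG.innerField hV),
    dirDeriv_mul hρ hUV, dirDeriv_innerField hW hU hV, dirDeriv_innerField hW hUG hV,
    key (hW.nabla hU), key hU, nablaSq, inner_sub_left, innerField,
    real_inner_comm (nabla U (grad f) x), real_inner_comm (U x)]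
  ring

/-- The differential of the scalar curvature of a gradient Ricci almost soliton. -/
lemma dirDeriv_scal_of_isGradientRicciAlmostSoliton (h : IsGradientRicciAlmostSoliton n f ρ)
    (hW : FieldSmoothNear W x) : dirDeriv W (scal (n := n)) x
      = 2 * ricci (W x) (grad f x) + 2 * ((n : ℝ) - 1) * dirDeriv W ρ x := by
  obtain ⟨E, hE⟩ := exists_isOrthonormalFrameNear (n := n) x
  obtain ⟨b, hb⟩ := hE.exists_basis
  have hG : FieldSmoothNear (grad (n := n) f) x :=
    SmoothNear.grad (Eventually.of_forall h.smooth_potential)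
  have hs := hE.smooth
  have h1 (i : Fin n) : (inner ℝ (E i x) (E i x) : ℝ) = 1 := by
    rw [real_inner_self_eq_norm_sq, hE.orthonormal.self_of_nhds.1 i, one_pow]
  have h2 := dirDeriv_scal_eq_sum hE hW
  have h3 := contracted_bianchi hE hW
  have h4 (i : Fin n) : covRic (E i) W (E i) x = dirDeriv (E i) ρ x * inner ℝ (W x) (E i x)
      - inner ℝ (riem (E i) W (grad f) x) (E i x)
      - inner ℝ (nablaSq W (E i) (grad f) x) (E i x) := by
    rw [covRic_eq_of_isGradientRicciAlmostSoliton h (hs i) hW (hs i),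
      ← nablaSq_sub_nablaSq_swap (hs i) hW hG, inner_sub_left]
    ring
  have h5 : ∑ i, dirDeriv (E i) ρ x * inner ℝ (W x) (E i x) = dirDeriv W ρ x := by
    have := congrArg (mvfderiv (𝓡 n) ρ x) (b.sum_repr' (W x))
    simp only [hb, map_sum, map_smul, smul_eq_mul] at this
    rw [dirDeriv, ← this]
    exact Finset.sum_congr rfl fun i _ => by rw [real_inner_comm, mul_comm, dirDeriv]
  simp only [h4, Finset.sum_sub_distrib, h5, ← ricci_eq_sum hE hW hG] at h3
  simp only [covRic_eq_of_isGradientRicciAlmostSoliton h hW (hs _) (hs _), h1, mul_one,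
    Finset.sum_sub_distrib, Finset.sum_const, Finset.card_univ, Fintype.card_fin,
    nsmul_eq_mul] at h2
  -- With S = ∑ ⟨∇²_{W,E_i}∇f, E_i⟩, `h2` is dR(W) = n dρ(W) - S and `h3` is dR(W) = 2 (dρ(W) -
  -- Ric(W, ∇f) - S). Twice `h2` minus `h3` eliminates S.
  linarith

end Soliton

end

/-! ### Derivatives along curves. -/

variable {n : ℕ} {M : Type*} [TopologicalSpace M] [ChartedSpace (EuclideanSpace ℝ (Fin n)) M]

lemma hasDerivAt_comp_curve {f : M → ℝ} {γ : ℝ → M} {t : ℝ}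
    (hf : MDifferentiableAt (𝓡 n) 𝓘(ℝ, ℝ) f (γ t))
    (hγ : MDifferentiableAt 𝓘(ℝ, ℝ) (𝓡 n) γ t) :
    HasDerivAt (fun s => f (γ s)) (mvfderiv (𝓡 n) f (γ t) (velocity n γ t)) t := by
  have h : HasFDerivAt (𝕜 := ℝ) (E := ℝ) (F := ℝ) (fun s => f (γ s)) _ t :=
    (hf.hasMFDerivAt.comp t hγ.hasMFDerivAt).hasFDerivAt
  exact h.hasDerivAt

variable [IsManifold (𝓡 n) ∞ M] [RiemannianBundle (fun x : M => TangentSpace (𝓡 n) x)]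
  [IsContMDiffRiemannianBundle (𝓡 n) ∞ (EuclideanSpace ℝ (Fin n))
      (fun x : M => TangentSpace (𝓡 n) x)]
variable {f ρ : M → ℝ}

lemma mvfderiv_scal_of_isGradientRicciAlmostSoliton (h : IsGradientRicciAlmostSoliton n f ρ)
    (x : M) (v : TangentSpace (𝓡 n) x) : mvfderiv (𝓡 n) (scal (n := n)) x v
      = 2 * ricci v (grad f x) + 2 * ((n : ℝ) - 1) * mvfderiv (𝓡 n) ρ x v := by
  have := dirDeriv_scal_of_isGradientRicciAlmostSoliton h (fieldSmoothNear_localExt v)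
  simpa only [dirDeriv, localExt_self] using this

lemma mvfderiv_inner_grad_grad {x : M} (hf : SmoothNear n f x) (v : TangentSpace (𝓡 n) x) :
    mvfderiv (𝓡 n) (innerField (grad (n := n) f) (grad f)) x v
      = 2 * hess f v (grad f x) := by
  have hv := fieldSmoothNear_localExt v
  have := dirDeriv_innerField hv hf.grad hf.grad
  rw [dirDeriv, localExt_self] at this
  rw [this, hess]
  ring

lemma hasDerivAt_scal_add_norm_grad_sq (h : IsGradientRicciAlmostSoliton n f ρ) {γ : ℝ → M} {t : ℝ}
    (hγ : MDifferentiableAt 𝓘(ℝ, ℝ) (𝓡 n) γ t) :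
    HasDerivAt (fun s => scal (n := n) (γ s) + ‖grad (n := n) f (γ s)‖ ^ 2)
      (2 * ρ (γ t) * deriv (fun s => f (γ s)) t
        + 2 * ((n : ℝ) - 1) * deriv (fun s => ρ (γ s)) t) t := by
  have hf : SmoothNear n f (γ t) := Eventually.of_forall h.smooth_potential
  have hρ : SmoothNear n ρ (γ t) := Eventually.of_forall h.smooth_soliton
  have hG := hf.grad
  have h1 := (hasDerivAt_comp_curve (smoothNear_scal (n := n) (γ t)).mdiff hγ).add
    (hasDerivAt_comp_curve (hG.innerField hG).mdiff hγ)
  rw [(hasDerivAt_comp_curve hf.mdiff hγ).deriv, (hasDerivAt_comp_curve hρ.mdiff hγ).deriv]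
  have h2 := h.soliton_eq (γ t) (velocity n γ t) (grad f (γ t))
  rw [real_inner_comm, inner_grad] at h2
  rw [mvfderiv_scal_of_isGradientRicciAlmostSoliton h, mvfderiv_inner_grad_grad hf] at h1
  -- `h2` is the soliton equation evaluated on (γ', ∇f), with ⟨γ', ∇f⟩ rewritten as df(γ').
  refine (h1.congr_deriv (by linear_combination 2 * h2)).congr_of_eventuallyEq
    (Eventually.of_forall fun s => ?_)
  simp [innerField]

end AlmostSoliton

end

open AlmostSoliton in
theorem proposition4p1 {n : ℕ} {M : Type*} [TopologicalSpace M]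
    [ChartedSpace (EuclideanSpace ℝ (Fin n)) M] [IsManifold (𝓡 n) ∞ M]
    [RiemannianBundle (fun x : M => TangentSpace (𝓡 n) x)]
    [IsContMDiffRiemannianBundle (𝓡 n) ∞ (EuclideanSpace ℝ (Fin n))
      (fun x : M => TangentSpace (𝓡 n) x)]
    (f ρ : M → ℝ) (h : IsGradientRicciAlmostSoliton n f ρ) :
    -- `∂_i R = 2 R_ij ∂_j f + 2 (n - 1) ∂_i ρ`
    (MDifferentiable (𝓡 n) 𝓘(ℝ, ℝ) (scal (n := n) : M → ℝ) ∧
      ∀ (x : M) (v : TangentSpace (𝓡 n) x),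
        mvfderiv (𝓡 n) (scal (n := n)) x v =
          2 * ricci v (grad f x) + 2 * ((n : ℝ) - 1) * mvfderiv (𝓡 n) ρ x v) ∧
    -- along every geodesic `γ` issuing from `o`
    ∀ (o : M) (γ : ℝ → M) (a b : ℝ), a < 0 → 0 < b → γ 0 = o → IsGeodesicOn n γ a b →
      -- `R + |∇f|²` solves the radial equation
      (∀ t ∈ Ioo a b, HasDerivAt (fun s => scal (n := n) (γ s) + ‖grad (n := n) f (γ s)‖ ^ 2)
        (2 * ρ (γ t) * deriv (fun s => f (γ s)) t
          + 2 * ((n : ℝ) - 1) * deriv (fun s => ρ (γ s)) t) t) ∧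
      -- and it is equal to every solution `F` with the same initial value
      ∀ (ℓ : ℝ), 0 ≤ ℓ → ℓ < b → ∀ F : ℝ → ℝ, ContinuousOn F (Icc 0 ℓ) →
        F 0 = scal (n := n) o + ‖grad (n := n) f o‖ ^ 2 →
        (∀ t ∈ Ioo 0 ℓ, HasDerivAt F
          (2 * ρ (γ t) * deriv (fun s => f (γ s)) t
            + 2 * ((n : ℝ) - 1) * deriv (fun s => ρ (γ s)) t) t) →
        ∀ t ∈ Icc 0 ℓ, scal (n := n) (γ t) + ‖grad (n := n) f (γ t)‖ ^ 2 = F t := by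
  refine ⟨⟨fun x => (smoothNear_scal x).mdiff,
    mvfderiv_scal_of_isGradientRicciAlmostSoliton h⟩, ?_⟩
  rintro _ γ a b ha hb rfl hγ
  have hd (t : ℝ) (ht : t ∈ Ioo a b) := hasDerivAt_scal_add_norm_grad_sq h
    ((hγ.1.contMDiffAt (isOpen_Ioo.mem_nhds ht)).mdifferentiableAt (by simp))
  refine ⟨hd, fun ℓ _ hℓb F hF hF0 hFd t ht => ?_⟩
  have hsub (s : ℝ) (hs : s ∈ Icc 0 ℓ) : s ∈ Ioo a b :=
    ⟨ha.trans_le hs.1, hs.2.trans_lt hℓb⟩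
  have hc : ContinuousOn (fun s => scal (n := n) (γ s) + ‖grad (n := n) f (γ s)‖ ^ 2) (Icc 0 ℓ) :=
    fun s hs => (hd s (hsub s hs)).continuousAt.continuousWithinAt
  rcases ht.1.eq_or_lt with rfl | htpos
  · exact hF0.symm
  have hmem (s : ℝ) (hs : s ∈ Ioo 0 t) : s ∈ Ioo 0 ℓ := ⟨hs.1, hs.2.trans_le ht.2⟩
  have hIcc : Icc 0 t ⊆ Icc 0 ℓ := Icc_subset_Icc_right ht.2
  -- The mean value theorem on [0, t] for the difference, whose derivative is 0; at the endpoints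
  -- only continuity of F is available.
  obtain ⟨c, hc1, hc2⟩ := exists_hasDerivAt_eq_slope _ (fun _ => (0 : ℝ)) htpos
    ((hc.sub hF).mono hIcc) fun s hs => by
      simpa using (hd s (hsub s (Ioo_subset_Icc_self (hmem s hs)))).sub (hFd s (hmem s hs))
  rw [eq_comm, div_eq_zero_iff, or_iff_left (sub_pos.2 htpos).ne'] at hc2
  simp only [Pi.sub_apply, hF0, sub_self, sub_zero] at hc2
  exact sub_eq_zero.1 hc2
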